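/- Let $d\ge 1$ and $n\ge 0$ be integers. A planar tropical curve of genus $1$ and degree $d$ with $n$ marked unbounded edges consists of the following data. There is a finite connected graph $\Gamma$ (loops and multiple edges allowed) with bounded edges $e$ of lengths $l(e)>0$ and with unbounded edges, $n$ of which are marked $x_1,\dots,x_n$; every vertex has valence at least $3$ (a loop counts twice), and $\#\{\text{bounded edges}\}=\#\{\text{vertices}\}$, i.e. the genus $1+\#\{\text{bounded edges}\}-\#\{\text{vertices}\}$ is $1$. There is a map $h:\Gamma\to\mathbb{R}^2$ and, for each flag $F$ (a vertex with an edge emanating from it), an integer direction vector $v(F)\in\mathbb{Z}^2$, such that $h$ is given by $t\mapsto h(V)+t\,v(F)$ along the edge of a flag $F$ at $V$ (so the two flags of a bounded edge have opposite directions, and a loop has direction $0$). The direction vectors of all flags at each vertex sum to $0$, marked unbounded edges have direction $0$, and the unmarked unbounded edges consist of exactly $d$ edges in each of the directions $(1,1)$, $(-1,0)$, $(0,-1)$. Two such curves are isomorphic if there is a graph isomorphism that preserves lengths, $h$, and each of the marked edges $x_i$ (unmarked unbounded edges of equal direction may be permuted). Let $\mathcal{M}_{=1,n}(d)$ be the set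 of isomorphism classes of these curves. For each combinatorial type $\alpha$ (a graph with direction vectors) of such curves, let $\overline{C}_\alpha$ be the space of all pairs of lengths $l(e)\ge 0$ of the bounded edges and images $h(V)\in\mathbb{R}^2$ of the vertices with $h(V')=h(V)+l(e)\,v(e)$ for every bounded edge $e$ from $V$ to $V'$ with direction $v(e)$ at $V$, such that contracting all edges of length $0$ leaves a curve of genus $1$. It has the subspace topology of a finite-dimensional real vector space, and contraction of the edges of length $0$ defines a map $\overline{C}_\alpha\to\mathcal{M}_{=1,n}(d)$. Give $\mathcal{M}_{=1,n}(d)$ the finest topology that makes all these maps continuous. Then $\mathcal{M}_{=1,n}(d)$ is connected; more precisely, it is nonempty and any two of its points are joined by a path. -/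

import Mathlib

/-- The combinatorial data of an `n`-marked planar tropical curve: a finite graph whose vertices
are `V`, whose bounded edges are `E` (loops and multiple edges are allowed), whose unmarked
unbounded edges are `U`, and whose marked unbounded edges are `x_i`, `i : Fin n`.

Every bounded edge carries an auxiliary orientation from `tail` to `head`; its integer direction
vector is `dir e` for the flag at the tail and `-dir e` for the flag at the head. (Isomorphisms,
below, may reverse these orientations.) An unmarked unbounded edge `u` is attached at the vertex
`foot u` and has direction `udir u`; the marked unbounded edge `x_i` is attached at `mark i` and
has direction `0`. -/
structure PlanarType (n : ℕ) : Type 1 where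
  V : Type
  E : Type
  U : Type
  [finV : Fintype V]
  [finE : Fintype E]
  [finU : Fintype U]
  tail : E → V
  head : E → V
  dir : E → ℤ × ℤ
  foot : U → V
  udir : U → ℤ × ℤ
  mark : Fin n → V

attribute [instance] PlanarType.finV PlanarType.finE PlanarType.finU

namespace PlanarType

variable {n : ℕ}

/-- The graph is connected: it has a vertex, and any two vertices are joined by a chain of
bounded edges. -/
def IsConnected (T : PlanarType n) : Prop :=
  Nonempty T.V ∧
    ∀ v w : T.V, Relation.EqvGen (fun a b => ∃ e, T.tail e = a ∧ T.head e = b) v w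

/-- The genus `1 + #(bounded edges) - #(vertices)`. -/
def genus (T : PlanarType n) : ℤ :=
  1 + (Fintype.card T.E : ℤ) - (Fintype.card T.V : ℤ)

open scoped Classical in
/-- The valence of a vertex: the number of flags at it (a loop gives two flags). -/
noncomputable def valence (T : PlanarType n) (v : T.V) : ℕ :=
  (Finset.univ.filter fun e => T.tail e = v).card
    + (Finset.univ.filter fun e => T.head e = v).card
    + (Finset.univ.filter fun u => T.foot u = v).card
    + (Finset.univ.filter fun i => T.mark i = v).card

open scoped Classical in
/-- The balancing condition: at each vertex the direction vectors of all flags add up to `0`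
(the marked unbounded edges contribute `0`). -/
def IsBalanced (T : PlanarType n) : Prop :=
  ∀ v : T.V,
    (∑ e with T.tail e = v, T.dir e) + (∑ e with T.head e = v, -T.dir e)
      + (∑ u with T.foot u = v, T.udir u) = 0

/-- The degree: the multiset of direction vectors of the unmarked unbounded edges. -/
def degree (T : PlanarType n) : Multiset (ℤ × ℤ) :=
  (Finset.univ : Finset T.U).val.map T.udir

/-- The graph conditions on a planar tropical curve of genus `g` and of degree `d`, that is, with
`d` unmarked unbounded edges in each of the directions `(1,1)`, `(-1,0)`, `(0,-1)`. -/
structure IsTropical (T : PlanarType n) (g : ℤ) (d : ℕ) : Prop where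
  connected : T.IsConnected
  three_le_valence : ∀ v, 3 ≤ T.valence v
  balanced : T.IsBalanced
  genus_eq : T.genus = g
  degree_eq : T.degree =
    Multiset.replicate d (1, 1) + Multiset.replicate d (-1, 0) + Multiset.replicate d (0, -1)

/-- The map into the plane is determined by the images of the vertices. It is compatible with the
edge lengths `len` if every bounded edge `e` is mapped to a segment `a + t • dir e`,
`0 ≤ t ≤ len e`. -/
def IsCompatible (T : PlanarType n) (len : T.E → ℝ) (pos : T.V → ℝ × ℝ) : Prop :=
  ∀ e, pos (T.head e) =
    pos (T.tail e) + len e • (((T.dir e).1 : ℝ), ((T.dir e).2 : ℝ))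

/-- Two vertices are identified when they are joined by a chain of edges of length `0`. -/
def contractSetoid (T : PlanarType n) (len : T.E → ℝ) : Setoid T.V :=
  Relation.EqvGen.setoid fun a b => ∃ e, len e = 0 ∧ T.tail e = a ∧ T.head e = b

/-- The combinatorial data obtained by contracting all edges of length `0`. -/
noncomputable def contract (T : PlanarType n) (len : T.E → ℝ) : PlanarType n where
  V := Quotient (T.contractSetoid len)
  E := {e : T.E // len e ≠ 0}
  U := T.U
  finV := Fintype.ofFinite _
  finE := Fintype.ofFinite _
  tail e := Quotient.mk _ (T.tail e)
  head e := Quotient.mk _ (T.head e)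
  dir e := T.dir e
  foot u := Quotient.mk _ (T.foot u)
  udir := T.udir
  mark i := Quotient.mk _ (T.mark i)

/-- The closed cell of a combinatorial type inside genus `1` and degree `d`: edge lengths `≥ 0`
and compatible vertex positions, such that contracting the edges of length `0` still gives a
graph of genus `1` (so the cycle is not contracted to a point). It carries the topology of a
subspace of a real vector space. -/
def ClosedCell (T : PlanarType n) (d : ℕ) : Type :=
  {x : (T.E → ℝ) × (T.V → ℝ × ℝ) //
    (∀ e, 0 ≤ x.1 e) ∧ T.IsCompatible x.1 x.2 ∧ (T.contract x.1).IsTropical 1 d}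

instance (T : PlanarType n) (d : ℕ) : TopologicalSpace (T.ClosedCell d) :=
  inferInstanceAs (TopologicalSpace {x : (T.E → ℝ) × (T.V → ℝ × ℝ) //
    (∀ e, 0 ≤ x.1 e) ∧ T.IsCompatible x.1 x.2 ∧ (T.contract x.1).IsTropical 1 d})

theorem pos_eq_of_contract {T : PlanarType n} {len : T.E → ℝ} {pos : T.V → ℝ × ℝ}
    (h : T.IsCompatible len pos) (v w : T.V) (hvw : (T.contractSetoid len) v w) :
    pos v = pos w := by
  have hvw' : Relation.EqvGen
      (fun a b => ∃ e, len e = 0 ∧ T.tail e = a ∧ T.head e = b) v w := hvw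
  induction hvw' with
  | rel a b hab =>
    obtain ⟨e, he, rfl, rfl⟩ := hab
    simp [h e, he]
  | refl a => rfl
  | symm a b _ ih => exact (ih (by assumption)).symm
  | trans a b c _ _ ih₁ ih₂ => exact (ih₁ (by assumption)).trans (ih₂ (by assumption))

end PlanarType

/-- A planar tropical curve of genus `1` and degree `d` with `n` marked unbounded edges:
combinatorial data together with positive lengths of the bounded edges and a compatible map to
the plane. -/
structure PlanarCurve (d n : ℕ) : Type 1 where
  type : PlanarType n
  isTropical : type.IsTropical 1 d
  len : type.E → ℝ
  len_pos : ∀ e, 0 < len e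
  pos : type.V → ℝ × ℝ
  compatible : type.IsCompatible len pos

namespace PlanarCurve

variable {d n : ℕ}

/-- An isomorphism of planar tropical curves: an isomorphism of the underlying graphs that
preserves edge lengths, the map to the plane, and each marked unbounded edge. It may reverse
the auxiliary orientation of bounded edges and permute unmarked unbounded edges that have the
same direction. -/
structure Iso (C D : PlanarCurve d n) where
  onV : C.type.V ≃ D.type.V
  onE : C.type.E ≃ D.type.E
  onU : C.type.U ≃ D.type.U
  edge : ∀ e,
    (D.type.tail (onE e) = onV (C.type.tail e) ∧ D.type.head (onE e) = onV (C.type.head e) ∧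
      D.type.dir (onE e) = C.type.dir e) ∨
    (D.type.tail (onE e) = onV (C.type.head e) ∧ D.type.head (onE e) = onV (C.type.tail e) ∧
      D.type.dir (onE e) = -C.type.dir e)
  foot : ∀ u, D.type.foot (onU u) = onV (C.type.foot u)
  udir : ∀ u, D.type.udir (onU u) = C.type.udir u
  mark : ∀ i, D.type.mark i = onV (C.type.mark i)
  len : ∀ e, D.len (onE e) = C.len e
  pos : ∀ v, D.pos (onV v) = C.pos v

/-- The identity isomorphism. -/
def Iso.refl (C : PlanarCurve d n) : Iso C C where
  onV := Equiv.refl _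
  onE := Equiv.refl _
  onU := Equiv.refl _
  edge _ := Or.inl ⟨rfl, rfl, rfl⟩
  foot _ := rfl
  udir _ := rfl
  mark _ := rfl
  len _ := rfl
  pos _ := rfl

/-- The inverse isomorphism. -/
def Iso.symm {C D : PlanarCurve d n} (f : Iso C D) : Iso D C where
  onV := f.onV.symm
  onE := f.onE.symm
  onU := f.onU.symm
  edge e := by
    rcases f.edge (f.onE.symm e) with ⟨h₁, h₂, h₃⟩ | ⟨h₁, h₂, h₃⟩ <;>
      simp only [Equiv.apply_symm_apply] at h₁ h₂ h₃ <;> simp [h₁, h₂, h₃]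
  foot u := by
    have h := f.foot (f.onU.symm u)
    simp only [Equiv.apply_symm_apply] at h
    simp [h]
  udir u := by
    have h := f.udir (f.onU.symm u)
    simp only [Equiv.apply_symm_apply] at h
    exact h.symm
  mark i := by simp [f.mark i]
  len e := by
    have h := f.len (f.onE.symm e)
    simp only [Equiv.apply_symm_apply] at h
    exact h.symm
  pos v := by
    have h := f.pos (f.onV.symm v)
    simp only [Equiv.apply_symm_apply] at h
    exact h.symm

/-- The composition of isomorphisms. -/
def Iso.trans {B C D : PlanarCurve d n} (f : Iso B C) (g : Iso C D) : Iso B D where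
  onV := f.onV.trans g.onV
  onE := f.onE.trans g.onE
  onU := f.onU.trans g.onU
  edge e := by
    rcases f.edge e with ⟨h₁, h₂, h₃⟩ | ⟨h₁, h₂, h₃⟩ <;>
      rcases g.edge (f.onE e) with ⟨k₁, k₂, k₃⟩ | ⟨k₁, k₂, k₃⟩ <;>
      simp [h₁, h₂, h₃, k₁, k₂, k₃]
  foot u := by simp [g.foot, f.foot]
  udir u := by simp [g.udir, f.udir]
  mark i := by simp [g.mark, f.mark]
  len e := by simp [g.len, f.len]
  pos v := by simp [g.pos, f.pos]

/-- Isomorphism, as an equivalence relation. -/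
instance isoSetoid (d n : ℕ) : Setoid (PlanarCurve d n) where
  r C D := Nonempty (Iso C D)
  iseqv :=
    { refl := fun C => ⟨Iso.refl C⟩
      symm := fun ⟨f⟩ => ⟨f.symm⟩
      trans := fun ⟨f⟩ ⟨g⟩ => ⟨f.trans g⟩ }

/-- The curve represented by a point of a closed cell: contract all edges of length `0`. -/
noncomputable def ofClosedCell {T : PlanarType n} (x : T.ClosedCell d) : PlanarCurve d n where
  type := T.contract x.1.1
  isTropical := x.2.2.2
  len e := x.1.1 e.1
  len_pos e := lt_of_le_of_ne (x.2.1 e.1) (Ne.symm e.2)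
  pos := Quotient.lift x.1.2 (PlanarType.pos_eq_of_contract x.2.2.1)
  compatible e := x.2.2.1 e.1

end PlanarCurve

/-- The moduli space of planar tropical curves of genus `1` and degree `d` with `n` marked
unbounded edges. Its points are the isomorphism classes of such curves. -/
def PlanarModuli (d n : ℕ) : Type 1 :=
  Quotient (PlanarCurve.isoSetoid d n)

/-- The gluing map from a closed cell to the moduli space. -/
noncomputable def PlanarModuli.ofClosedCell {d n : ℕ} {T : PlanarType n} (x : T.ClosedCell d) :
    PlanarModuli d n :=
  Quotient.mk _ (PlanarCurve.ofClosedCell x)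

/-- The moduli space is glued from the closed cells of all combinatorial types of curves: a set
is open if and only if its preimage in the closed cell of each combinatorial type that occurs
is open. The boundary points of a cell are curves with fewer bounded edges. -/
noncomputable instance (d n : ℕ) : TopologicalSpace (PlanarModuli d n) :=
  ⨆ C : PlanarCurve d n,
    TopologicalSpace.coinduced
      (PlanarModuli.ofClosedCell : C.type.ClosedCell d → PlanarModuli d n) inferInstance

/-!
Every curve is joined by a path to one particular curve: a single vertex at the origin that carries
all unbounded edges and a loop of length `1` and direction `0`.

Straight lines in a closed cell are paths, so a curve is joined to its degenerations
(`PlanarModuli.joined_of_degeneration`). As the genus is `1`, there is exactly one cycle, and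
contracting the other bounded edges, which form a forest, leaves a curve whose bounded edges form a
cycle (`exists_joined_isCycle`). Such a curve is in turn a degeneration of a formal cycle
`cyclicType udir τ Q` with one unbounded edge at each vertex, attached in a linear order `τ`
(`exists_cyclicType`). The marked edges take part in this as unbounded edges of direction `0`.

The direction of the `m`-th edge of such a cycle is `v m = Q - ∑ δ w`, summed over the unbounded
edges `w` up to place `m`, and its points are the nonzero nonnegative lengths `l` with
`∑ l m • v m = 0`, up to the position in the plane. These form a convex set, so all of them are
joined (`joined_of_cyclicType`). Two neighbouring unbounded edges can be exchanged whenever there is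
a point at which the bounded edge between them has length `0` (`exists_ofClosedCell_swap`). Once
`v t = 0` for some `t`, the other edges can be contracted, which leaves the loop.

To reach this situation, take a relation supported on the edges from `i` to `k`, with `k - i`
minimal. It makes `v i` a point of the zonotope spanned by the directions `δ w` of the unbounded
edges in between, and as `(1,1)`, `(-1,0)`, `(0,-1)` form a unimodular system, `v i` is the sum of
some of these `δ w` (`exists_subset_sum_eq`). If these `w` come first after the `i`-th edge, then
some `v t` vanishes. They can be moved there: by Carathéodory's exchange step
(`exists_nonneg_relation_erase`) and the minimality of `k - i`, the edges `i` and `k` have a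
relation with any single edge strictly between them. If there are at least two such edges, each of
them can therefore be contracted. If there is only one, then `v i`, `v (i + 1)`, `v k` span a
triangle without further lattice points, so one of them vanishes (`exists_eq_zero_of_unimodular`).
The induction is `reachesLoop_of_support`.
-/

/-! ### Contracting edges: rank and flags -/

namespace PlanarType

variable {n : ℕ}

open scoped Classical in
/-- The sum over the flags at the vertex `v` of weights given on the tail flags, the head flags,
the unmarked and the marked unbounded edges. Valence and balancing are instances. -/
noncomputable def flagSum {A : Type*} [AddCommMonoid A] (T : PlanarType n) (a b : T.E → A)
    (c : T.U → A) (m : Fin n → A) (v : T.V) : A :=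
  (∑ e with T.tail e = v, a e) + (∑ e with T.head e = v, b e)
    + (∑ u with T.foot u = v, c u) + (∑ i with T.mark i = v, m i)

theorem flagSum_eq {A : Type*} [AddCommMonoid A] (T : PlanarType n) [DecidableEq T.V]
    (a b : T.E → A) (c : T.U → A) (m : Fin n → A) (v : T.V) :
    T.flagSum a b c m v = (∑ e with T.tail e = v, a e) + (∑ e with T.head e = v, b e)
      + (∑ u with T.foot u = v, c u) + (∑ i with T.mark i = v, m i) := by
  unfold flagSum
  congr!

theorem valence_eq_flagSum (T : PlanarType n) (v : T.V) :
    T.valence v = T.flagSum (fun _ => 1) (fun _ => 1) (fun _ => 1) (fun _ => 1) v := by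
  simp [valence, flagSum]

theorem isBalanced_iff (T : PlanarType n) :
    T.IsBalanced ↔ ∀ v, T.flagSum T.dir (fun e => -T.dir e) T.udir (fun _ => 0) v = 0 := by
  simp [IsBalanced, flagSum]

theorem genus_eq_natCard (T : PlanarType n) :
    T.genus = 1 + (Nat.card T.E : ℤ) - (Nat.card T.V : ℤ) := by
  simp [genus, Nat.card_eq_fintype_card]

theorem contract_mk_eq {T : PlanarType n} {len : T.E → ℝ} {e : T.E} (he : len e = 0) :
    (Quotient.mk (T.contractSetoid len) (T.tail e)) = Quotient.mk _ (T.head e) :=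
  Quotient.sound (Relation.EqvGen.rel _ _ ⟨e, he, rfl, rfl⟩)

/-- A function that agrees at the two ends of every edge of length `0` is constant on the classes
of vertices that are identified by the contraction. -/
theorem eq_of_contractSetoid {α : Type*} {T : PlanarType n} {len : T.E → ℝ} {f : T.V → α}
    (hf : ∀ e, len e = 0 → f (T.tail e) = f (T.head e)) {v w : T.V}
    (h : T.contractSetoid len v w) : f v = f w := by
  have h' : Relation.EqvGen
      (fun a b => ∃ e, len e = 0 ∧ T.tail e = a ∧ T.head e = b) v w := h
  clear h
  induction h' with
  | rel a b hab => obtain ⟨e, he, rfl, rfl⟩ := hab; exact hf e he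
  | refl a => rfl
  | symm a b _ ih => exact ih.symm
  | trans a b c _ _ ih₁ ih₂ => exact ih₁.trans ih₂

open scoped Classical in
/-- Summing over the vertices of a contracted class counts the flags at the contracted vertex,
and both flags of each contracted edge of the class. -/
theorem sum_flagSum {A : Type*} [AddCommMonoid A] (T : PlanarType n) (len : T.E → ℝ)
    (a b : T.E → A) (c : T.U → A) (m : Fin n → A) (q : (T.contract len).V) :
    ∑ v with Quotient.mk (T.contractSetoid len) v = q, T.flagSum a b c m v =
      (T.contract len).flagSum (fun e => a e.1) (fun e => b e.1) c m q
        + ∑ e with len e = 0 ∧ Quotient.mk (T.contractSetoid len) (T.tail e) = q,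
            (a e + b e) := by
  have key : ∀ {ι : Type} [Fintype ι] (g : ι → T.V) (f : ι → A),
      ∑ v with Quotient.mk (T.contractSetoid len) v = q, ∑ e with g e = v, f e =
        ∑ e with Quotient.mk (T.contractSetoid len) (g e) = q, f e := by
    intro ι _ g f
    simp only [Finset.sum_filter]
    rw [← Finset.sum_filter, Finset.sum_comm]
    refine Finset.sum_congr rfl fun e _ => ?_
    rw [Finset.sum_ite_eq]
    simp
  have split : ∀ (g : T.E → T.V) (f : T.E → A),
      ∑ e with Quotient.mk (T.contractSetoid len) (g e) = q, f e =
        (∑ e : (T.contract len).E with Quotient.mk (T.contractSetoid len) (g e.1) = q, f e.1)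
          + ∑ e with len e = 0 ∧ Quotient.mk (T.contractSetoid len) (g e) = q, f e := by
    intro g f
    rw [← Finset.sum_filter_add_sum_filter_not _ (fun e => len e ≠ 0)]
    congr 1
    · symm
      refine Finset.sum_bij (fun e _ => e.1) ?_ ?_ ?_ ?_
      · intro e he
        have := e.2
        simp only [Finset.mem_filter, Finset.mem_univ, true_and] at he ⊢
        exact ⟨he, this⟩
      · intro e _ e' _ h
        exact Subtype.ext h
      · intro e he
        simp only [Finset.mem_filter, Finset.mem_univ, true_and] at he
        exact ⟨⟨e, he.2⟩, Finset.mem_filter.mpr ⟨Finset.mem_univ _, he.1⟩, rfl⟩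
      · intro e _
        rfl
    · refine Finset.sum_congr ?_ fun _ _ => rfl
      ext e
      simp [and_comm]
  have hhead : ∑ e with len e = 0 ∧ Quotient.mk (T.contractSetoid len) (T.head e) = q, b e =
      ∑ e with len e = 0 ∧ Quotient.mk (T.contractSetoid len) (T.tail e) = q, b e := by
    refine Finset.sum_congr ?_ fun _ _ => rfl
    ext e
    simp only [Finset.mem_filter, Finset.mem_univ, true_and]
    refine and_congr_right fun he => ?_
    rw [contract_mk_eq he]
  simp only [flagSum, Finset.sum_add_distrib]
  rw [key, key, key, key, split T.tail a, split T.head b, hhead]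
  change _ = (∑ e : (T.contract len).E with Quotient.mk (T.contractSetoid len) (T.tail e.1) = q,
    a e.1) + (∑ e : (T.contract len).E with
      Quotient.mk (T.contractSetoid len) (T.head e.1) = q, b e.1)
    + (∑ u with Quotient.mk (T.contractSetoid len) (T.foot u) = q, c u)
    + (∑ i with Quotient.mk (T.contractSetoid len) (T.mark i) = q, m i) + _
  abel

/-- The coboundary map of the graph formed by the edges of length `0`. -/
def coboundary (T : PlanarType n) (len : T.E → ℝ) :
    (T.V → ℝ) →ₗ[ℝ] ({e // len e = 0} → ℝ) where
  toFun f e := f (T.head e.1) - f (T.tail e.1)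
  map_add' f g := by ext e; simp only [Pi.add_apply]; ring
  map_smul' c f := by ext e; simp only [Pi.smul_apply, smul_eq_mul, RingHom.id_apply]; ring

theorem coboundary_apply (T : PlanarType n) (len : T.E → ℝ) (f : T.V → ℝ)
    (e : {e // len e = 0}) :
    T.coboundary len f e = f (T.head e.1) - f (T.tail e.1) := rfl

theorem finrank_ker_coboundary (T : PlanarType n) (len : T.E → ℝ) :
    Module.finrank ℝ (LinearMap.ker (T.coboundary len)) =
      Nat.card (Quotient (T.contractSetoid len)) := by
  classical
  have : Fintype (Quotient (T.contractSetoid len)) := Fintype.ofFinite _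
  have hr : LinearMap.range (LinearMap.funLeft ℝ ℝ (Quotient.mk (T.contractSetoid len))) =
      LinearMap.ker (T.coboundary len) := by
    ext f
    constructor
    · rintro ⟨g, rfl⟩
      rw [LinearMap.mem_ker]
      ext e
      rw [coboundary_apply]
      simp [LinearMap.funLeft_apply, contract_mk_eq e.2]
    · intro hf
      rw [LinearMap.mem_ker] at hf
      have hf' : ∀ e, len e = 0 → f (T.tail e) = f (T.head e) := by
        intro e he
        have := congrFun hf ⟨e, he⟩
        rw [coboundary_apply] at this
        simpa using (sub_eq_zero.mp this).symm
      exact ⟨Quotient.lift f fun v w h => eq_of_contractSetoid hf' h, by ext v; rfl⟩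
  rw [← hr, LinearMap.finrank_range_of_inj
    (LinearMap.funLeft_injective_of_surjective ℝ ℝ _ Quotient.mk_surjective)]
  simp [Nat.card_eq_fintype_card]

theorem finrank_range_coboundary (T : PlanarType n) (len : T.E → ℝ) :
    Module.finrank ℝ (LinearMap.range (T.coboundary len)) +
      Nat.card (Quotient (T.contractSetoid len)) = Nat.card T.V := by
  classical
  rw [← finrank_ker_coboundary, LinearMap.finrank_range_add_finrank_ker]
  simp [Nat.card_eq_fintype_card]

/-- Contracting an edge lowers the number of vertices by at most one. -/
theorem card_le_card_quotient_add (T : PlanarType n) (len : T.E → ℝ) :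
    Nat.card T.V ≤ Nat.card (Quotient (T.contractSetoid len)) + Nat.card {e // len e = 0} := by
  classical
  have h := finrank_range_coboundary T len
  have h' := Submodule.finrank_le (LinearMap.range (T.coboundary len))
  simp only [Module.finrank_fintype_fun_eq_card, ← Nat.card_eq_fintype_card] at h'
  omega

theorem card_zero_add_card_ne_zero (T : PlanarType n) (len : T.E → ℝ) :
    Nat.card {e // len e = 0} + Nat.card {e // len e ≠ 0} = Nat.card T.E := by
  classical
  simp only [Nat.card_eq_fintype_card]
  exact Fintype.card_subtype_compl (fun e => len e = 0) ▸
    Nat.add_sub_of_le (Fintype.card_subtype_le _)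

/-- If contraction does not change the genus, then the contracted edges form a forest, that is,
their coboundary map is onto. -/
theorem coboundary_surjective {T : PlanarType n} {len : T.E → ℝ}
    (h : (T.contract len).genus = T.genus) : Function.Surjective (T.coboundary len) := by
  classical
  rw [genus_eq_natCard, genus_eq_natCard] at h
  change 1 + (Nat.card {e // len e ≠ 0} : ℤ) - (Nat.card (Quotient (T.contractSetoid len)) : ℤ)
    = _ at h
  have h₁ := card_zero_add_card_ne_zero T len
  have h₂ := finrank_range_coboundary T len
  rw [← LinearMap.range_eq_top]
  apply Submodule.eq_top_of_finrank_eq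
  simp only [Module.finrank_fintype_fun_eq_card, ← Nat.card_eq_fintype_card]
  omega

/-- In a contracted class there are fewer contracted edges than vertices, if contraction does not
change the genus: the class is a tree. -/
theorem card_class_edges_lt {T : PlanarType n} {len : T.E → ℝ}
    (h : (T.contract len).genus = T.genus) (q : Quotient (T.contractSetoid len)) :
    Nat.card {e // len e = 0 ∧ Quotient.mk (T.contractSetoid len) (T.tail e) = q} <
      Nat.card {v // Quotient.mk (T.contractSetoid len) v = q} := by
  classical
  let B : ({v // Quotient.mk (T.contractSetoid len) v = q} → ℝ) →ₗ[ℝ]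
      ({e // len e = 0 ∧ Quotient.mk (T.contractSetoid len) (T.tail e) = q} → ℝ) :=
    { toFun := fun f e => f ⟨T.head e.1, (contract_mk_eq e.2.1).symm.trans e.2.2⟩
        - f ⟨T.tail e.1, e.2.2⟩
      map_add' := fun f g => by ext e; simp only [Pi.add_apply]; ring
      map_smul' := fun c f => by
        ext e; simp only [Pi.smul_apply, smul_eq_mul, RingHom.id_apply]; ring }
  have hB : ∀ f e, B f e = f ⟨T.head e.1, (contract_mk_eq e.2.1).symm.trans e.2.2⟩
    - f ⟨T.tail e.1, e.2.2⟩ := fun _ _ => rfl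
  have hsurj : Function.Surjective B := by
    intro k
    obtain ⟨f, hf⟩ := coboundary_surjective h
      (fun e => if hq : Quotient.mk (T.contractSetoid len) (T.tail e.1) = q
        then k ⟨e.1, e.2, hq⟩ else 0)
    refine ⟨fun v => f v.1, ?_⟩
    ext e
    have := congrFun hf ⟨e.1, e.2.1⟩
    rw [coboundary_apply, dif_pos e.2.2] at this
    rw [hB]
    exact this
  have hker : 0 < Module.finrank ℝ (LinearMap.ker B) := by
    rw [Module.finrank_pos_iff_exists_ne_zero]
    refine ⟨⟨fun _ => 1, ?_⟩, ?_⟩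
    · rw [LinearMap.mem_ker]
      ext e
      rw [hB]
      simp
    · intro h0
      obtain ⟨v, hv⟩ := Quotient.exists_rep q
      have := congrFun (congrArg Subtype.val h0) ⟨v, hv⟩
      simp at this
  have hrk := LinearMap.finrank_range_add_finrank_ker B
  rw [LinearMap.range_eq_top.mpr hsurj, finrank_top] at hrk
  simp only [Module.finrank_fintype_fun_eq_card, ← Nat.card_eq_fintype_card] at hrk
  omega

/-- A contraction of a tropical curve type that does not change the genus is again such a type. -/
theorem IsTropical.contract {T : PlanarType n} {g : ℤ} {d : ℕ} (hT : T.IsTropical g d)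
    {len : T.E → ℝ} (h : (T.contract len).genus = g) : (T.contract len).IsTropical g d where
  connected := by
    refine ⟨hT.connected.1.map (Quotient.mk _), ?_⟩
    intro q r
    induction q using Quotient.inductionOn with | _ v => ?_
    induction r using Quotient.inductionOn with | _ w => ?_
    have hvw := hT.connected.2 v w
    induction hvw with
    | rel a b hab =>
      obtain ⟨e, rfl, rfl⟩ := hab
      by_cases he : len e = 0
      · rw [contract_mk_eq he]
        exact Relation.EqvGen.refl _
      · exact Relation.EqvGen.rel _ _ ⟨⟨e, he⟩, rfl, rfl⟩
    | refl a => exact Relation.EqvGen.refl _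
    | symm a b _ ih => exact ih.symm
    | trans a b c _ _ ih₁ ih₂ => exact ih₁.trans _ _ _ ih₂
  three_le_valence := by
    classical
    intro q
    have hs := sum_flagSum T len (fun _ => 1) (fun _ => 1) (fun _ => 1) (fun _ => 1) q
    replace hs := hs.trans (congrArg (· + _) (valence_eq_flagSum (T.contract len) q).symm)
    have h3 : (Finset.univ.filter fun v => Quotient.mk (T.contractSetoid len) v = q).card * 3 ≤
        ∑ v with Quotient.mk (T.contractSetoid len) v = q,
          T.flagSum (fun _ => 1) (fun _ => 1) (fun _ => 1) (fun _ => 1) v := by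
      refine Finset.card_nsmul_le_sum _ _ 3 fun v _ => ?_
      rw [← valence_eq_flagSum]
      exact hT.three_le_valence v
    have hlt := card_class_edges_lt (h.trans hT.genus_eq.symm) q
    rw [Nat.card_eq_fintype_card, Nat.card_eq_fintype_card, Fintype.card_subtype,
      Fintype.card_subtype] at hlt
    rw [Finset.sum_const, smul_eq_mul] at hs
    omega
  balanced := by
    classical
    rw [isBalanced_iff]
    intro q
    have hs := sum_flagSum T len T.dir (fun e => -T.dir e) T.udir (fun _ => 0) q
    rw [Finset.sum_eq_zero fun v _ => (isBalanced_iff T).mp hT.balanced v] at hs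
    simp only [add_neg_cancel, Finset.sum_const_zero, add_zero] at hs
    exact hs.symm
  genus_eq := h
  degree_eq := hT.degree_eq

end PlanarType

/-! ### Paths inside closed cells -/

namespace PlanarType

variable {n : ℕ}

/-- The contraction only depends on which lengths vanish. -/
theorem contract_congr (T : PlanarType n) {len len' : T.E → ℝ}
    (h : ∀ e, len e = 0 ↔ len' e = 0) : T.contract len = T.contract len' := by
  let F : (T.E → Prop) → PlanarType n := fun Z =>
    { V := Quotient (Relation.EqvGen.setoid fun a b => ∃ e, Z e ∧ T.tail e = a ∧ T.head e = b)
      E := {e : T.E // ¬ Z e}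
      U := T.U
      finV := Fintype.ofFinite _
      finE := Fintype.ofFinite _
      tail := fun e => Quotient.mk _ (T.tail e)
      head := fun e => Quotient.mk _ (T.head e)
      dir := fun e => T.dir e
      foot := fun u => Quotient.mk _ (T.foot u)
      udir := T.udir
      mark := fun i => Quotient.mk _ (T.mark i) }
  change F (fun e => len e = 0) = F (fun e => len' e = 0)
  exact congrArg F (funext fun e => propext (h e))

theorem contractSetoid_contract {T : PlanarType n} {len len' : T.E → ℝ}
    (h : ∀ e, len e = 0 → len' e = 0) (v w : T.V) :
    (T.contract len).contractSetoid (fun e => len' e.1) (Quotient.mk _ v) (Quotient.mk _ w) ↔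
      T.contractSetoid len' v w := by
  constructor
  · intro hvw
    have hl : ∀ a b : T.V, T.contractSetoid len a b →
        Quotient.mk (T.contractSetoid len') a = Quotient.mk _ b := fun a b hab =>
      eq_of_contractSetoid (fun e he => contract_mk_eq (h e he)) hab
    exact Quotient.exact (eq_of_contractSetoid
      (f := (Quotient.lift (Quotient.mk (T.contractSetoid len')) hl : (T.contract len).V → _))
      (fun (e : (T.contract len).E) he => contract_mk_eq (e := e.1) he) hvw)
  · intro hvw
    have := eq_of_contractSetoid (f := fun v => Quotient.mk
      ((T.contract len).contractSetoid (fun e => len' e.1)) (Quotient.mk (T.contractSetoid len) v))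
      (fun e he => ?_) hvw
    · exact Quotient.exact this
    · by_cases h0 : len e = 0
      · exact congrArg _ (contract_mk_eq h0)
      · exact contract_mk_eq (T := T.contract len) (len := fun e => len' e.1) (e := ⟨e, h0⟩) he

/-- Contracting in two steps gives the same genus as contracting at once. -/
theorem genus_contract_contract {T : PlanarType n} {len len' : T.E → ℝ}
    (h : ∀ e, len e = 0 → len' e = 0) :
    ((T.contract len).contract fun e => len' e.1).genus = (T.contract len').genus := by
  rw [genus_eq_natCard, genus_eq_natCard]
  have hE : Nat.card ((T.contract len).contract fun e => len' e.1).E =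
      Nat.card (T.contract len').E :=
    Nat.card_congr
      { toFun := fun e => ⟨e.1.1, e.2⟩
        invFun := fun e => ⟨⟨e.1, fun h0 => e.2 (h _ h0)⟩, e.2⟩
        left_inv := fun _ => rfl
        right_inv := fun _ => rfl }
  have hV : Nat.card ((T.contract len).contract fun e => len' e.1).V =
      Nat.card (T.contract len').V := by
    symm
    refine Nat.card_congr (Equiv.ofBijective (Quotient.lift (fun v => Quotient.mk
      ((T.contract len).contractSetoid (fun e => len' e.1))
        (Quotient.mk (T.contractSetoid len) v))
      fun v w hvw => Quotient.sound ((contractSetoid_contract h v w).mpr hvw)) ⟨?_, ?_⟩)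
    · intro a b hab
      induction a using Quotient.inductionOn with | _ v => ?_
      induction b using Quotient.inductionOn with | _ w => ?_
      exact Quotient.sound ((contractSetoid_contract h v w).mp (Quotient.exact hab))
    · intro a
      induction a using Quotient.inductionOn with | _ v => ?_
      induction v using Quotient.inductionOn with | _ v => ?_
      exact ⟨Quotient.mk _ v, rfl⟩
  rw [hE, hV]

variable {d : ℕ}

/-- A point `y` of a closed cell whose lengths vanish wherever those of `z` do, as a point of the
closed cell of the curve that `z` represents. -/
def ClosedCell.restrict {T : PlanarType n} (z y : T.ClosedCell d)
    (h : ∀ e, z.1.1 e = 0 → y.1.1 e = 0) : (T.contract z.1.1).ClosedCell d :=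
  ⟨(fun e => y.1.1 e.1, Quotient.lift y.1.2 fun v w hvw =>
      eq_of_contractSetoid (fun e he => by rw [y.2.2.1 e, h e he]; simp) hvw),
    fun e => y.2.1 e.1, fun e => y.2.2.1 e.1,
    z.2.2.2.contract ((genus_contract_contract h).trans y.2.2.2.genus_eq)⟩

/-- The point at time `t` of the straight line from `z` to `x` in a closed cell, where the lengths
of `x` vanish wherever those of `z` do. -/
noncomputable def ClosedCell.line {T : PlanarType n} (z x : T.ClosedCell d)
    (h : ∀ e, z.1.1 e = 0 → x.1.1 e = 0) (t : unitInterval) : T.ClosedCell d :=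
  ⟨(fun e => (1 - t) * z.1.1 e + t * x.1.1 e,
      fun v => (1 - t : ℝ) • z.1.2 v + (t : ℝ) • x.1.2 v), by
    have ht0 := t.2.1
    have ht1 := t.2.2
    refine ⟨fun e => ?_, fun e => ?_, ?_⟩
    · exact add_nonneg (mul_nonneg (by linarith) (z.2.1 e)) (mul_nonneg ht0 (x.2.1 e))
    · simp only [z.2.2.1 e, x.2.2.1 e, smul_add, add_smul, mul_smul]
      abel
    · rcases eq_or_lt_of_le ht1 with h1 | h1
      · rw [T.contract_congr (len' := x.1.1) fun e => by simp [h1]]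
        exact x.2.2.2
      · rw [T.contract_congr (len' := z.1.1) fun e => ?_]
        · exact z.2.2.2
        · have h1' : 0 < 1 - (t : ℝ) := by linarith
          constructor
          · intro he
            have ha := mul_nonneg h1'.le (z.2.1 e)
            have hb := mul_nonneg ht0 (x.2.1 e)
            have : (1 - (t : ℝ)) * z.1.1 e = 0 := by linarith
            exact (mul_eq_zero.mp this).resolve_left h1'.ne'
          · intro he
            simp [he, h e he]⟩

end PlanarType

namespace PlanarModuli

open PlanarType

variable {d n : ℕ}

/-- The isomorphism class of a curve. -/
def mk (C : PlanarCurve d n) : PlanarModuli d n :=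
  Quotient.mk _ C

theorem continuous_ofClosedCell (C : PlanarCurve d n) :
    Continuous (PlanarModuli.ofClosedCell : C.type.ClosedCell d → PlanarModuli d n) :=
  continuous_iff_coinduced_le.mpr
    (le_iSup (fun C : PlanarCurve d n => TopologicalSpace.coinduced
      (PlanarModuli.ofClosedCell : C.type.ClosedCell d → PlanarModuli d n) inferInstance) C)

/-- A point of a closed cell represents the curve `D` if the vertices of `D` are the classes of
vertices joined by edges of length `0` and the bounded edges of `D` are the edges of positive
length. -/
theorem ofClosedCell_eq_mk {T : PlanarType n} (x : T.ClosedCell d) (D : PlanarCurve d n)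
    (φ : T.V → D.type.V) (hsurj : Function.Surjective φ)
    (hφ : ∀ e, x.1.1 e = 0 → φ (T.tail e) = φ (T.head e))
    (hφ' : ∀ v w, φ v = φ w → T.contractSetoid x.1.1 v w)
    (ψ : {e // x.1.1 e ≠ 0} ≃ D.type.E) (χ : T.U ≃ D.type.U)
    (hedge : ∀ e,
      (D.type.tail (ψ e) = φ (T.tail e.1) ∧ D.type.head (ψ e) = φ (T.head e.1) ∧
        D.type.dir (ψ e) = T.dir e.1) ∨
      (D.type.tail (ψ e) = φ (T.head e.1) ∧ D.type.head (ψ e) = φ (T.tail e.1) ∧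
        D.type.dir (ψ e) = -T.dir e.1))
    (hfoot : ∀ u, D.type.foot (χ u) = φ (T.foot u))
    (hudir : ∀ u, D.type.udir (χ u) = T.udir u)
    (hmark : ∀ i, D.type.mark i = φ (T.mark i))
    (hlen : ∀ e, D.len (ψ e) = x.1.1 e.1)
    (hpos : ∀ v, D.pos (φ v) = x.1.2 v) :
    PlanarModuli.ofClosedCell x = PlanarModuli.mk D := by
  refine Quotient.sound ⟨
    { onV := Equiv.ofBijective (Quotient.lift φ fun v w hvw => eq_of_contractSetoid hφ hvw)
        ⟨?_, ?_⟩
      onE := ψ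
      onU := χ
      edge := hedge
      foot := hfoot
      udir := hudir
      mark := hmark
      len := hlen
      pos := ?_ }⟩
  · intro a b hab
    induction a using Quotient.inductionOn with | _ v => ?_
    induction b using Quotient.inductionOn with | _ w => ?_
    exact Quotient.sound (hφ' v w hab)
  · intro a
    obtain ⟨v, rfl⟩ := hsurj a
    exact ⟨Quotient.mk _ v, rfl⟩
  · intro a
    induction a using Quotient.inductionOn with | _ v => ?_
    exact hpos v

theorem ofClosedCell_restrict {T : PlanarType n} (z y : T.ClosedCell d)
    (h : ∀ e, z.1.1 e = 0 → y.1.1 e = 0) :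
    PlanarModuli.ofClosedCell (z.restrict y h) = PlanarModuli.ofClosedCell y := by
  refine ofClosedCell_eq_mk (T := T.contract z.1.1) (z.restrict y h) (PlanarCurve.ofClosedCell y)
    (Quotient.lift (Quotient.mk (T.contractSetoid y.1.1)) fun v w hvw =>
      eq_of_contractSetoid (fun e he => contract_mk_eq (h e he)) hvw)
    ?_ ?_ ?_
    { toFun := fun e => ⟨e.1.1, e.2⟩
      invFun := fun e => ⟨⟨e.1, fun h0 => e.2 (h _ h0)⟩, e.2⟩
      left_inv := fun _ => rfl
      right_inv := fun _ => rfl }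
    (Equiv.refl _) (fun _ => Or.inl ⟨rfl, rfl, rfl⟩) (fun _ => rfl) (fun _ => rfl) (fun _ => rfl)
    (fun _ => rfl) ?_
  · intro a
    induction a using Quotient.inductionOn with | _ v => ?_
    exact ⟨Quotient.mk _ v, rfl⟩
  · intro e he
    exact contract_mk_eq (e := e.1) he
  · intro a b hab
    induction a using Quotient.inductionOn with | _ v => ?_
    induction b using Quotient.inductionOn with | _ w => ?_
    exact (contractSetoid_contract h v w).mpr (Quotient.exact hab)
  · intro a
    induction a using Quotient.inductionOn with | _ v => ?_
    rfl

/-- A curve is joined to its degenerations. The type `T` need not occur as the type of a curve,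
since the path runs in the closed cell of the type of the curve represented by `z`. -/
theorem joined_of_degeneration {T : PlanarType n} (z x : T.ClosedCell d)
    (h : ∀ e, z.1.1 e = 0 → x.1.1 e = 0) :
    Joined (PlanarModuli.ofClosedCell z) (PlanarModuli.ofClosedCell x) := by
  have hline : ∀ t e, z.1.1 e = 0 → (z.line x h t).1.1 e = 0 := fun t e he => by
    simp [ClosedCell.line, he, h e he]
  have hcont : Continuous fun t => z.restrict (z.line x h t) (hline t) := by
    refine Continuous.subtype_mk (Continuous.prodMk ?_ ?_) _
    · refine continuous_pi fun e => ?_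
      simp only [ClosedCell.line]
      fun_prop
    · refine continuous_pi fun a => ?_
      induction a using Quotient.inductionOn with | _ v => ?_
      simp only [ClosedCell.line, Quotient.lift_mk]
      fun_prop
  refine ⟨⟨⟨fun t => PlanarModuli.ofClosedCell (z.line x h t), ?_⟩, ?_, ?_⟩⟩
  · have := (continuous_ofClosedCell (PlanarCurve.ofClosedCell z)).comp hcont
    refine this.congr fun t => ?_
    exact ofClosedCell_restrict z (z.line x h t) (hline t)
  · change PlanarModuli.ofClosedCell (z.line x h 0) = _
    congr 1
    refine Subtype.ext (Prod.ext ?_ ?_) <;> ext <;> simp [ClosedCell.line]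
  · change PlanarModuli.ofClosedCell (z.line x h 1) = _
    congr 1
    refine Subtype.ext (Prod.ext ?_ ?_) <;> ext <;> simp [ClosedCell.line]

theorem contract_curve_isTropical (C : PlanarCurve d n) :
    (C.type.contract C.len).IsTropical 1 d := by
  refine C.isTropical.contract ?_
  rw [← C.isTropical.genus_eq, genus_eq_natCard, genus_eq_natCard]
  have hE : Nat.card (C.type.contract C.len).E = Nat.card C.type.E :=
    Nat.card_congr (Equiv.subtypeUnivEquiv fun e => (C.len_pos e).ne')
  have hV : Nat.card (C.type.contract C.len).V = Nat.card C.type.V := by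
    symm
    refine Nat.card_congr (Equiv.ofBijective (Quotient.mk _) ⟨fun v w hvw => ?_,
      Quotient.mk_surjective⟩)
    exact eq_of_contractSetoid (f := id) (fun e he => absurd he (C.len_pos e).ne')
      (Quotient.exact hvw)
  rw [hE, hV]

end PlanarModuli

/-- A curve as a point of the closed cell of its own type. -/
noncomputable def PlanarCurve.toClosedCell {d n : ℕ} (C : PlanarCurve d n) :
    C.type.ClosedCell d :=
  ⟨(C.len, C.pos), fun e => (C.len_pos e).le, C.compatible,
    PlanarModuli.contract_curve_isTropical C⟩

theorem PlanarModuli.ofClosedCell_toClosedCell {d n : ℕ} (C : PlanarCurve d n) :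
    PlanarModuli.ofClosedCell C.toClosedCell = PlanarModuli.mk C :=
  ofClosedCell_eq_mk C.toClosedCell C id Function.surjective_id
    (fun e he => absurd he (C.len_pos e).ne')
    (fun v w h => by cases h; exact Relation.EqvGen.refl _)
    (Equiv.subtypeUnivEquiv fun e => (C.len_pos e).ne') (Equiv.refl _)
    (fun _ => Or.inl ⟨rfl, rfl, rfl⟩) (fun _ => rfl) (fun _ => rfl) (fun _ => rfl) (fun _ => rfl)
    fun _ => rfl

/-! ### Reduction to a cycle -/

namespace PlanarType

variable {n : ℕ}

/-- The bounded edge `e` joins `v` and `w`, in one of the two orientations. -/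
def Joins (T : PlanarType n) (e : T.E) (v w : T.V) : Prop :=
  (T.tail e = v ∧ T.head e = w) ∨ (T.tail e = w ∧ T.head e = v)

/-- The bounded part of the graph is a single cycle: its vertices and its bounded edges are
numbered cyclically, and the `i`-th edge joins the `i`-th vertex to the next one. -/
def IsCycle (T : PlanarType n) : Prop :=
  ∃ (L : ℕ) (f : Fin (L + 1) ≃ T.V) (g : Fin (L + 1) ≃ T.E),
    ∀ i, T.Joins (g i) (f i) (f (i + 1))

/-- A connected graph with as many edges as vertices has an edge that is not a bridge: otherwise
its coboundary map would be onto, whereas constants are in the kernel. -/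
theorem exists_not_bridge {T : PlanarType n} (hT : T.IsConnected)
    (hcard : Nat.card T.E = Nat.card T.V) [DecidableEq T.E] :
    ∃ e, T.contractSetoid (Pi.single e 1) (T.head e) (T.tail e) := by
  classical
  by_contra! hb
  have hsurj : Function.Surjective (T.coboundary 0) := by
    intro h
    let ind : T.E → T.V → ℝ := fun e v =>
      if T.contractSetoid (Pi.single e 1) (T.head e) v then 1 else 0
    refine ⟨fun v => ∑ e, h ⟨e, rfl⟩ * ind e v, ?_⟩
    ext ⟨e', he'⟩
    rw [coboundary_apply, ← Finset.sum_sub_distrib, Finset.sum_eq_single e']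
    · have h1 : ind e' (T.head e') = 1 := if_pos (Setoid.refl' _ _)
      have h2 : ind e' (T.tail e') = 0 := if_neg (hb e')
      simp [h1, h2]
    · intro e _ hne
      have : ind e (T.tail e') = ind e (T.head e') := by
        have hq : T.contractSetoid (Pi.single e 1) (T.tail e') (T.head e') :=
          Quotient.exact (contract_mk_eq (by simp [Pi.single_eq_of_ne hne.symm]))
        have : T.contractSetoid (Pi.single e 1) (T.head e) (T.tail e') ↔
            T.contractSetoid (Pi.single e 1) (T.head e) (T.head e') :=
          ⟨fun h => Setoid.trans' _ h hq, fun h => Setoid.trans' _ h (Setoid.symm' _ hq)⟩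
        simp only [ind, this]
      simp [this]
    · simp
  have hr := finrank_range_coboundary T 0
  rw [LinearMap.range_eq_top.mpr hsurj, finrank_top] at hr
  have h0 : Nat.card {e : T.E // (0 : T.E → ℝ) e = 0} = Nat.card T.E :=
    Nat.card_congr (Equiv.subtypeUnivEquiv fun e => rfl)
  simp only [Module.finrank_fintype_fun_eq_card, ← Nat.card_eq_fintype_card] at hr
  obtain ⟨v⟩ := hT.1
  have : Nonempty (Quotient (T.contractSetoid 0)) := ⟨Quotient.mk _ v⟩
  have := Nat.card_pos (α := Quotient (T.contractSetoid 0))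
  omega

/-- A connected graph with as many edges as vertices contains a cycle: an edge that is not a
bridge, together with a path between its end points that avoids it. -/
theorem exists_cycle {T : PlanarType n} (hT : T.IsConnected)
    (hcard : Nat.card T.E = Nat.card T.V) :
    ∃ (L : ℕ) (f : Fin (L + 1) → T.V) (g : Fin (L + 1) → T.E),
      Function.Injective f ∧ Function.Injective g ∧ ∀ i, T.Joins (g i) (f i) (f (i + 1)) := by
  classical
  obtain ⟨e₀, he₀⟩ := exists_not_bridge hT hcard
  let G : SimpleGraph T.V :=
    SimpleGraph.fromRel fun a b => ∃ e, e ≠ e₀ ∧ T.tail e = a ∧ T.head e = b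
  have hreach : G.Reachable (T.head e₀) (T.tail e₀) := by
    refine SimpleGraph.ConnectedComponent.exact
      (eq_of_contractSetoid (f := G.connectedComponentMk) (fun e he => ?_) he₀)
    have hne : e ≠ e₀ := by
      rintro rfl
      simp at he
    by_cases hl : T.tail e = T.head e
    · rw [hl]
    · exact SimpleGraph.ConnectedComponent.sound (SimpleGraph.Adj.reachable
        ((SimpleGraph.fromRel_adj _ _ _).mpr ⟨hl, Or.inl ⟨e, hne, rfl, rfl⟩⟩))
  obtain ⟨p, hp⟩ := hreach.exists_isPath
  have hinj := hp.getVert_injOn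
  have hedge : ∀ i : ℕ, ∃ e, i < p.length →
      e ≠ e₀ ∧ T.Joins e (p.getVert i) (p.getVert (i + 1)) := by
    intro i
    by_cases hi : i < p.length
    · obtain ⟨_, ⟨e, h₁, h₂⟩ | ⟨e, h₁, h₂⟩⟩ :=
        (SimpleGraph.fromRel_adj _ _ _).mp (p.adj_getVert_succ hi)
      · exact ⟨e, fun _ => ⟨h₁, Or.inl h₂⟩⟩
      · exact ⟨e, fun _ => ⟨h₁, Or.inr h₂⟩⟩
    · exact ⟨e₀, fun h => absurd h hi⟩
  choose k hk using hedge
  have hkinj : ∀ i j, i < p.length → j < p.length → k i = k j → i = j := by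
    intro i j hi hj hij
    have h₁ := (hk i hi).2
    have h₂ := (hk j hj).2
    rw [← hij] at h₂
    have hI : ∀ a b, a ≤ p.length → b ≤ p.length → p.getVert a = p.getVert b → a = b :=
      fun a b ha hb h => hinj ha hb h
    rcases h₁ with ⟨a, b⟩ | ⟨a, b⟩ <;> rcases h₂ with ⟨a', b'⟩ | ⟨a', b'⟩
    · exact hI _ _ hi.le hj.le (a.symm.trans a')
    · have := hI _ _ hi.le hj (a.symm.trans a')
      have := hI _ _ hi hj.le (b.symm.trans b')
      omega
    · have := hI _ _ hi hj.le (a.symm.trans a')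
      have := hI _ _ hi.le hj (b.symm.trans b')
      omega
    · exact hI _ _ hi.le hj.le (b.symm.trans b')
  refine ⟨p.length, fun i => p.getVert i, fun i => if i.1 < p.length then k i else e₀,
    ?_, ?_, ?_⟩
  · intro i j hij
    exact Fin.ext (hinj (Nat.le_of_lt_succ i.2) (Nat.le_of_lt_succ j.2) hij)
  · intro i j hij
    have hi := i.2
    have hj := j.2
    dsimp only at hij
    split_ifs at hij with h₁ h₂ h₂
    · exact Fin.ext (hkinj _ _ h₁ h₂ hij)
    · exact absurd hij (hk _ h₁).1
    · exact absurd hij.symm (hk _ h₂).1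
    · exact Fin.ext (by omega)
  · intro i
    induction i using Fin.lastCases with
    | last =>
      simp only [Fin.val_last, lt_irrefl, if_false, Fin.last_add_one, Fin.val_zero,
        SimpleGraph.Walk.getVert_zero, SimpleGraph.Walk.getVert_length]
      exact Or.inl ⟨rfl, rfl⟩
    | cast j =>
      have hj : (j.castSucc : ℕ) < p.length := j.2
      simp only [if_pos hj, Fin.val_add_one_of_lt (Fin.castSucc_lt_last j)]
      exact (hk _ hj).2

end PlanarType

namespace PlanarModuli

open PlanarType

variable {d n : ℕ}

/-- Every curve is joined to one whose bounded edges form a single cycle: contract the edges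
outside of the cycle. -/
theorem exists_joined_isCycle (C : PlanarCurve d n) :
    ∃ D : PlanarCurve d n, D.type.IsCycle ∧
      Joined (mk C) (mk D) := by
  classical
  have hcard : Nat.card C.type.E = Nat.card C.type.V := by
    have := C.isTropical.genus_eq
    rw [genus_eq_natCard] at this
    omega
  obtain ⟨L, f, g, hf, hg, hfg⟩ := exists_cycle C.isTropical.connected hcard
  let len : C.type.E → ℝ := fun e => if e ∈ Set.range g then C.len e else 0
  have hlen0 : ∀ e, len e ≠ 0 ↔ e ∈ Set.range g := by
    intro e
    by_cases he : e ∈ Set.range g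
    · simp only [len, if_pos he, he, iff_true]
      exact (C.len_pos e).ne'
    · simp only [len, if_neg he, he, ne_eq, not_true]
  let c : Fin (L + 1) → Quotient (C.type.contractSetoid len) := fun i => Quotient.mk _ (f i)
  have hnz : Nat.card {e // len e ≠ 0} = L + 1 := by
    rw [Nat.card_congr ((Equiv.subtypeEquivRight hlen0).trans (Equiv.ofInjective g hg).symm)]
    simp
  have hcs : Function.Surjective c := by
    have hinv : ∀ v w : C.type.V, (∃ i, c i = Quotient.mk _ v) ↔ ∃ i, c i = Quotient.mk _ w := by
      intro v w
      have h := C.isTropical.connected.2 v w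
      induction h with
      | rel a b hab =>
        obtain ⟨e, rfl, rfl⟩ := hab
        by_cases he : len e = 0
        · rw [contract_mk_eq he]
        · obtain ⟨i, rfl⟩ := (hlen0 e).mp he
          rcases hfg i with ⟨h₁, h₂⟩ | ⟨h₁, h₂⟩
          · rw [h₁, h₂]
            exact ⟨fun _ => ⟨_, rfl⟩, fun _ => ⟨_, rfl⟩⟩
          · rw [h₁, h₂]
            exact ⟨fun _ => ⟨_, rfl⟩, fun _ => ⟨_, rfl⟩⟩
      | refl a => exact Iff.rfl
      | symm a b _ ih => exact ih.symm
      | trans a b c _ _ ih₁ ih₂ => exact ih₁.trans ih₂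
    intro q
    induction q using Quotient.inductionOn with | _ v => ?_
    exact (hinv (f 0) v).mp ⟨0, rfl⟩
  have hge := card_le_card_quotient_add C.type len
  have hsum := card_zero_add_card_ne_zero C.type len
  have hcb : Function.Bijective c := by
    refine hcs.bijective_of_nat_card_le ?_
    simp only [Nat.card_eq_fintype_card, Fintype.card_fin] at *
    omega
  have hcQ : Nat.card (Quotient (C.type.contractSetoid len)) = L + 1 := by
    rw [← Nat.card_congr (Equiv.ofBijective c hcb)]
    simp
  let ρ : C.type.V → Fin (L + 1) := fun v => (Equiv.ofBijective c hcb).symm (Quotient.mk _ v)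
  have hρ : ∀ i, ρ (f i) = i := fun i => (Equiv.ofBijective c hcb).symm_apply_apply i
  let x : C.type.ClosedCell d := ⟨(len, fun v => C.pos (f (ρ v))), by
    refine ⟨fun e => ?_, fun e => ?_, ?_⟩
    · dsimp only [len]
      split_ifs
      exacts [(C.len_pos e).le, le_rfl]
    · by_cases he : len e = 0
      · have : ρ (C.type.head e) = ρ (C.type.tail e) := by
          simp only [ρ]
          rw [contract_mk_eq he]
        simp [he, this]
      · have he' := (hlen0 e).mp he
        have h := C.compatible e
        simp only [len, if_pos he']
        obtain ⟨i, rfl⟩ := he'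
        rcases hfg i with ⟨h₁, h₂⟩ | ⟨h₁, h₂⟩
        · rw [h₁, h₂] at h
          rw [h₁, h₂, hρ, hρ]
          exact h
        · rw [h₁, h₂] at h
          rw [h₁, h₂, hρ, hρ]
          exact h
    · refine C.isTropical.contract ?_
      rw [genus_eq_natCard]
      change 1 + (Nat.card {e // len e ≠ 0} : ℤ)
        - (Nat.card (Quotient (C.type.contractSetoid len)) : ℤ) = 1
      rw [hnz, hcQ]
      simp⟩
  refine ⟨PlanarCurve.ofClosedCell x, ⟨L, Equiv.ofBijective c hcb,
    (Equiv.ofInjective g hg).trans (Equiv.subtypeEquivRight hlen0).symm, fun i => ?_⟩, ?_⟩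
  · rcases hfg i with ⟨h₁, h₂⟩ | ⟨h₁, h₂⟩
    · exact Or.inl ⟨congrArg (Quotient.mk _) h₁, congrArg (Quotient.mk _) h₂⟩
    · exact Or.inr ⟨congrArg (Quotient.mk _) h₁, congrArg (Quotient.mk _) h₂⟩
  · rw [← ofClosedCell_toClosedCell C]
    change Joined _ (PlanarModuli.ofClosedCell x)
    exact joined_of_degeneration C.toClosedCell x fun e he => absurd he (C.len_pos e).ne'

end PlanarModuli

/-! ### Cycles with one unbounded edge at each vertex -/

namespace PlanarType

/-- The integer vectors inside the real plane. -/
def toPlane : ℤ × ℤ →+ ℝ × ℝ :=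
  (Int.castAddHom ℝ).prodMap (Int.castAddHom ℝ)

theorem toPlane_apply (a : ℤ × ℤ) : toPlane a = ((a.1 : ℝ), (a.2 : ℝ)) := rfl

variable {d n M : ℕ} {U : Type} [Fintype U]

/-- The directions `udir` are `d` times each of `(1,1)`, `(-1,0)`, `(0,-1)`. -/
def HasDegree (udir : U → ℤ × ℤ) (d : ℕ) : Prop :=
  (Finset.univ : Finset U).val.map udir =
    Multiset.replicate d (1, 1) + Multiset.replicate d (-1, 0) + Multiset.replicate d (0, -1)

theorem HasDegree.sum_eq_zero {udir : U → ℤ × ℤ} (h : HasDegree udir d) : ∑ u, udir u = 0 := by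
  have := congrArg Multiset.sum h
  simp only [Multiset.sum_add, Multiset.sum_replicate] at this
  rw [Finset.sum, this]
  ext <;> simp

theorem HasDegree.mem {udir : U → ℤ × ℤ} (h : HasDegree udir d) (u : U) :
    udir u = (1, 1) ∨ udir u = (-1, 0) ∨ udir u = (0, -1) := by
  have : udir u ∈ (Finset.univ : Finset U).val.map udir :=
    Multiset.mem_map_of_mem _ (Finset.mem_univ u)
  rw [h] at this
  simp only [Multiset.mem_add, Multiset.mem_replicate] at this
  tauto

theorem HasDegree.card {udir : U → ℤ × ℤ} (h : HasDegree udir d) : Fintype.card U = 3 * d := by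
  have := congrArg Multiset.card h
  simp only [Multiset.card_map, Multiset.card_add, Multiset.card_replicate] at this
  rw [← Finset.card_univ, Finset.card_def, this]
  ring

/-- The directions of all unbounded edges, unmarked and marked; the latter have direction `0`. -/
def endDir (n : ℕ) (udir : U → ℤ × ℤ) : U ⊕ Fin n → ℤ × ℤ :=
  Sum.elim udir fun _ => 0

theorem HasDegree.sum_endDir {udir : U → ℤ × ℤ} (h : HasDegree udir d) :
    ∑ w, endDir n udir w = 0 := by
  rw [Fintype.sum_sum_type]
  simp [endDir, h.sum_eq_zero]

/-- The direction of the `m`-th edge of a cycle along which the unbounded edges are attached in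
the order `τ`, and whose last edge has direction `Q`. -/
def edgeDir (udir : U → ℤ × ℤ) (τ : U ⊕ Fin n ≃ Fin (M + 1)) (Q : ℤ × ℤ) (m : Fin (M + 1)) :
    ℤ × ℤ :=
  Q - ∑ w with τ w ≤ m, endDir n udir w

/-- The type of curves whose bounded edges form a cycle and which have exactly one unbounded edge
at each vertex: the edge `w` is attached at the vertex `τ w`, and the `m`-th bounded edge leads
from the vertex `m` to the cyclically next one. -/
def cyclicType (udir : U → ℤ × ℤ) (τ : U ⊕ Fin n ≃ Fin (M + 1)) (Q : ℤ × ℤ) : PlanarType n where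
  V := Fin (M + 1)
  E := Fin (M + 1)
  U := U
  tail m := m
  head m := m + 1
  dir := edgeDir udir τ Q
  foot u := τ (Sum.inl u)
  udir := udir
  mark i := τ (Sum.inr i)

theorem flagSum_cyclicType {A : Type*} [AddCommMonoid A] (udir : U → ℤ × ℤ)
    (τ : U ⊕ Fin n ≃ Fin (M + 1)) (Q : ℤ × ℤ) (a b : Fin (M + 1) → A) (c : U → A)
    (k : Fin n → A) (m : Fin (M + 1)) :
    (cyclicType udir τ Q).flagSum a b c k m = a m + b (m - 1) + Sum.elim c k (τ.symm m) := by
  classical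
  have h₁ : ∑ w with τ w = m, Sum.elim c k w = Sum.elim c k (τ.symm m) := by
    rw [Finset.sum_filter, Finset.sum_eq_single (τ.symm m)]
    · simp
    · intro w _ hw
      rw [if_neg]
      rintro rfl
      simp at hw
    · simp
  rw [Finset.sum_filter, Fintype.sum_sum_type] at h₁
  simp only [Sum.elim_inl, Sum.elim_inr, ← Finset.sum_filter] at h₁
  rw [← h₁, ← add_assoc]
  have h₂ : ∀ e : Fin (M + 1), e + 1 = m ↔ e = m - 1 := fun e => eq_sub_iff_add_eq.symm
  have h₃ : (cyclicType udir τ Q).flagSum a b c k m =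
      (∑ e : Fin (M + 1) with e = m, a e) + (∑ e : Fin (M + 1) with e + 1 = m, b e)
        + (∑ u with τ (Sum.inl u) = m, c u) + (∑ i with τ (Sum.inr i) = m, k i) := by
    exact @flagSum_eq n A _ (cyclicType udir τ Q) (inferInstanceAs (DecidableEq (Fin (M + 1))))
      a b c k m
  rw [h₃]
  simp only [h₂]
  congr
  · rw [Finset.sum_filter, Finset.sum_ite_eq' Finset.univ m a]
    simp
  · rw [Finset.sum_filter, Finset.sum_ite_eq' Finset.univ (m - 1) b]
    simp

theorem edgeDir_add_one {udir : U → ℤ × ℤ} (h : HasDegree udir d) (τ : U ⊕ Fin n ≃ Fin (M + 1))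
    (Q : ℤ × ℤ) (m : Fin (M + 1)) :
    edgeDir udir τ Q (m + 1) = edgeDir udir τ Q m - endDir n udir (τ.symm (m + 1)) := by
  classical
  rw [edgeDir, edgeDir, sub_sub]
  congr 1
  induction m using Fin.lastCases with
  | last =>
    have h₁ : (Finset.univ.filter fun w => τ w ≤ Fin.last M) = Finset.univ :=
      Finset.filter_true_of_mem fun w _ => Fin.le_last _
    have h₂ : (Finset.univ.filter fun w => τ w ≤ 0) = {τ.symm 0} := by
      ext w
      simp [Equiv.eq_symm_apply]
    rw [Fin.last_add_one, h₁, h₂, h.sum_endDir]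
    simp
  | cast m =>
    have h₁ : (Finset.univ.filter fun w => τ w ≤ m.castSucc + 1) =
        insert (τ.symm (m.castSucc + 1)) (Finset.univ.filter fun w => τ w ≤ m.castSucc) := by
      ext w
      have := Fin.val_add_one_of_lt (Fin.castSucc_lt_last m)
      simp only [Finset.mem_filter, Finset.mem_univ, true_and, Finset.mem_insert,
        Equiv.eq_symm_apply, Fin.le_def, Fin.ext_iff, this]
      omega
    rw [h₁, Finset.sum_insert, add_comm]
    have := Fin.val_add_one_of_lt (Fin.castSucc_lt_last m)
    simp only [Finset.mem_filter, Finset.mem_univ, true_and, Equiv.apply_symm_apply, Fin.le_def,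
      this]
    omega

theorem isTropical_cyclicType {udir : U → ℤ × ℤ} (h : HasDegree udir d)
    (τ : U ⊕ Fin n ≃ Fin (M + 1)) (Q : ℤ × ℤ) : (cyclicType udir τ Q).IsTropical 1 d where
  connected := by
    have h0 : ∀ v : Fin (M + 1), Relation.EqvGen (fun a b => ∃ e,
        (cyclicType udir τ Q).tail e = a ∧ (cyclicType udir τ Q).head e = b)
        (0 : Fin (M + 1)) v := by
      intro v
      induction v using Fin.induction with
      | zero => exact Relation.EqvGen.refl _
      | succ i ih =>
        refine ih.trans _ _ _ (Relation.EqvGen.rel _ _ ⟨i.castSucc, rfl, ?_⟩)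
        exact Fin.coeSucc_eq_succ
    exact ⟨⟨(0 : Fin (M + 1))⟩, fun v w => (h0 v).symm.trans _ _ _ (h0 w)⟩
  three_le_valence v := by
    rw [valence_eq_flagSum]
    erw [flagSum_cyclicType]
    cases τ.symm v <;> exact le_rfl
  balanced := by
    rw [isBalanced_iff]
    intro (v : Fin (M + 1))
    erw [flagSum_cyclicType]
    have := edgeDir_add_one h τ Q (v - 1)
    rw [sub_add_cancel] at this
    change edgeDir udir τ Q v + -edgeDir udir τ Q (v - 1) + endDir n udir (τ.symm v) = 0
    rw [this]
    abel
  genus_eq := by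
    change 1 + (Fintype.card (Fin (M + 1)) : ℤ) - (Fintype.card (Fin (M + 1)) : ℤ) = 1
    ring
  degree_eq := h

/-- A point of a closed cell has an edge of positive length. -/
theorem ClosedCell.exists_len_ne_zero {T : PlanarType n} (x : T.ClosedCell d) :
    ∃ e, x.1.1 e ≠ 0 := by
  by_contra! h
  have hg := x.2.2.2.genus_eq
  rw [genus_eq_natCard] at hg
  have : IsEmpty (T.contract x.1.1).E := ⟨fun e => e.2 (h e.1)⟩
  have := x.2.2.2.connected.1
  have hV := Nat.card_pos (α := (T.contract x.1.1).V)
  rw [Nat.card_of_isEmpty] at hg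
  omega

/-- A contraction of the cycle preserves the genus as soon as one edge survives. -/
theorem isTropical_contract_cyclicType {udir : U → ℤ × ℤ} (h : HasDegree udir d)
    (τ : U ⊕ Fin n ≃ Fin (M + 1)) (Q : ℤ × ℤ) {len : Fin (M + 1) → ℝ} (hlen : ∃ e, len e ≠ 0) :
    ((cyclicType udir τ Q).contract len).IsTropical 1 d := by
  have hT := isTropical_cyclicType h τ Q
  refine hT.contract ?_
  set T := cyclicType udir τ Q with hTdef
  obtain ⟨e₀, he₀⟩ := hlen
  have hsurj : Function.Surjective
      (fun e : {e : T.E // len e ≠ 0} => Quotient.mk (T.contractSetoid len) (T.tail e.1)) := by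
    have key : ∀ k : Fin (M + 1),
        ∃ e : {e : T.E // len e ≠ 0}, Quotient.mk (T.contractSetoid len) (T.tail e.1) =
          Quotient.mk _ (e₀ - k : Fin (M + 1)) := by
      intro k
      induction k using Fin.induction with
      | zero => exact ⟨⟨e₀, he₀⟩, by rw [sub_zero]; rfl⟩
      | succ k ih =>
        by_cases h0 : len (e₀ - k.succ) = 0
        · obtain ⟨e, he⟩ := ih
          have hk : e₀ - k.succ + 1 = e₀ - k.castSucc := by
            rw [← Fin.coeSucc_eq_succ]
            abel
          rw [← hk] at he
          exact ⟨e, he.trans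
            (contract_mk_eq (T := T) (len := len) (e := (e₀ - k.succ : Fin (M + 1))) h0).symm⟩
        · exact ⟨⟨(e₀ - k.succ : Fin (M + 1)), h0⟩, rfl⟩
    intro q
    induction q using Quotient.inductionOn with | _ v => ?_
    obtain ⟨e, he⟩ := key (e₀ - (show Fin (M + 1) from v))
    rw [sub_sub_cancel] at he
    exact ⟨e, he⟩
  have h₁ := Nat.card_le_card_of_surjective _ hsurj
  have h₂ := card_le_card_quotient_add T len
  have h₃ := card_zero_add_card_ne_zero T len
  have h₄ : Nat.card T.E = Nat.card T.V := rfl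
  rw [genus_eq_natCard]
  change 1 + (Nat.card {e : T.E // len e ≠ 0} : ℤ)
    - (Nat.card (Quotient (T.contractSetoid len)) : ℤ) = 1
  omega

/-- Lengths of the edges of a cycle that are compatible with the directions: the cycle closes
up, and it is not contracted to a point. -/
structure IsRelation (udir : U → ℤ × ℤ) (τ : U ⊕ Fin n ≃ Fin (M + 1)) (Q : ℤ × ℤ)
    (len : Fin (M + 1) → ℝ) : Prop where
  nonneg : ∀ m, 0 ≤ len m
  exists_ne_zero : ∃ m, len m ≠ 0
  sum_eq_zero : ∑ m, len m • toPlane (edgeDir udir τ Q m) = 0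

theorem ClosedCell.isRelation {udir : U → ℤ × ℤ} {τ : U ⊕ Fin n ≃ Fin (M + 1)} {Q : ℤ × ℤ}
    (x : (cyclicType udir τ Q).ClosedCell d) : IsRelation udir τ Q x.1.1 where
  nonneg := x.2.1
  exists_ne_zero := x.exists_len_ne_zero
  sum_eq_zero := by
    have hc : ∀ m : Fin (M + 1), x.1.2 (m + 1 : Fin (M + 1)) =
        x.1.2 m + x.1.1 m • toPlane (edgeDir udir τ Q m) := x.2.2.1
    have hs : ∑ m : Fin (M + 1), x.1.2 (m + 1 : Fin (M + 1)) =
        ∑ m : Fin (M + 1), x.1.2 m :=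
      Equiv.sum_comp (Equiv.addRight (1 : Fin (M + 1))) x.1.2
    simp only [hc] at hs
    erw [Finset.sum_add_distrib] at hs
    exact left_eq_add.mp hs.symm

theorem IsRelation.exists_closedCell {udir : U → ℤ × ℤ} (h : HasDegree udir d)
    {τ : U ⊕ Fin n ≃ Fin (M + 1)} {Q : ℤ × ℤ} {len : Fin (M + 1) → ℝ}
    (hl : IsRelation udir τ Q len) :
    ∃ x : (cyclicType udir τ Q).ClosedCell d, x.1.1 = len := by
  refine ⟨⟨(len, fun m : Fin (M + 1) =>
    ∑ j : Fin (M + 1) with j < m, len j • toPlane (edgeDir udir τ Q j)), hl.nonneg, ?_,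
    isTropical_contract_cyclicType h τ Q hl.exists_ne_zero⟩, rfl⟩
  intro (e : Fin (M + 1))
  change ∑ j : Fin (M + 1) with j < e + 1, len j • toPlane (edgeDir udir τ Q j) =
    (∑ j : Fin (M + 1) with j < e, len j • toPlane (edgeDir udir τ Q j))
      + len e • toPlane (edgeDir udir τ Q e)
  have hins : ∀ e : Fin (M + 1),
      (∑ j : Fin (M + 1) with j < e, len j • toPlane (edgeDir udir τ Q j))
        + len e • toPlane (edgeDir udir τ Q e) =
      ∑ j : Fin (M + 1) with j ≤ e, len j • toPlane (edgeDir udir τ Q j) := by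
    intro e
    have : (Finset.univ.filter fun j => j ≤ e) =
        insert e (Finset.univ.filter fun j => j < e) := by
      ext j
      simp [le_iff_eq_or_lt]
    rw [this, Finset.sum_insert (by simp), add_comm]
  rw [hins]
  induction e using Fin.lastCases with
  | last =>
    have h₁ : (Finset.univ.filter fun j => j ≤ Fin.last M) = Finset.univ :=
      Finset.filter_true_of_mem fun w _ => Fin.le_last _
    rw [h₁, hl.sum_eq_zero, Fin.last_add_one]
    simp
  | cast m =>
    refine Finset.sum_congr ?_ fun _ _ => rfl
    ext j
    have := Fin.val_add_one_of_lt (Fin.castSucc_lt_last m)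
    simp only [Finset.mem_filter, Finset.mem_univ, true_and, Fin.le_def, Fin.lt_def, this]
    omega

/-- Exchanging two adjacent unbounded edges only changes the direction of the bounded edge
between them. -/
theorem edgeDir_swap (udir : U → ℤ × ℤ) (τ : U ⊕ Fin n ≃ Fin (M + 1)) (Q : ℤ × ℤ)
    {i j m : Fin (M + 1)} (hij : (j : ℕ) = i + 1) (hm : m ≠ i) :
    edgeDir udir (τ.trans (Equiv.swap i j)) Q m = edgeDir udir τ Q m := by
  rw [edgeDir, edgeDir]
  congr 1
  refine Finset.sum_congr ?_ fun _ _ => rfl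
  ext w
  have hm' : (m : ℕ) ≠ i := fun h => hm (Fin.ext h)
  rw [Finset.mem_filter, Finset.mem_filter]
  simp only [Finset.mem_univ, true_and, Equiv.trans_apply, Equiv.swap_apply_def]
  split_ifs with h₁ h₂ <;> simp only [Fin.le_def, Fin.ext_iff] at * <;> omega

end PlanarType

namespace PlanarModuli

open PlanarType

variable {d n M : ℕ} {U : Type} [Fintype U]

/-- All curves in the closed cell of a cycle are joined: the relations form a convex set. -/
theorem joined_of_cyclicType {udir : U → ℤ × ℤ} (h : HasDegree udir d)
    {τ : U ⊕ Fin n ≃ Fin (M + 1)} {Q : ℤ × ℤ} (x y : (cyclicType udir τ Q).ClosedCell d) :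
    Joined (PlanarModuli.ofClosedCell x) (PlanarModuli.ofClosedCell y) := by
  let z : (cyclicType udir τ Q).ClosedCell d :=
    ⟨(fun e => x.1.1 e + y.1.1 e, fun v => x.1.2 v + y.1.2 v),
      fun e => add_nonneg (x.2.1 e) (y.2.1 e),
      fun e => by
        simp only [x.2.2.1 e, y.2.2.1 e, add_smul]
        abel,
      isTropical_contract_cyclicType h τ Q (by
        obtain ⟨e, he⟩ := x.exists_len_ne_zero
        exact ⟨e, fun h0 => he (le_antisymm (by linarith [y.2.1 e, h0]) (x.2.1 e))⟩)⟩
  have hx : ∀ e, z.1.1 e = 0 → x.1.1 e = 0 := fun e (he : x.1.1 e + y.1.1 e = 0) =>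
    le_antisymm (by linarith [y.2.1 e]) (x.2.1 e)
  have hy : ∀ e, z.1.1 e = 0 → y.1.1 e = 0 := fun e (he : x.1.1 e + y.1.1 e = 0) =>
    le_antisymm (by linarith [x.2.1 e]) (y.2.1 e)
  exact (joined_of_degeneration z x hx).symm.trans (joined_of_degeneration z y hy)

/-- Where the edge between two adjacent unbounded edges is contracted, their order does not
matter. -/
theorem exists_ofClosedCell_swap {udir : U → ℤ × ℤ} (h : HasDegree udir d)
    {τ : U ⊕ Fin n ≃ Fin (M + 1)} {Q : ℤ × ℤ} {i j : Fin (M + 1)} (hij : (j : ℕ) = i + 1)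
    (x : (cyclicType udir τ Q).ClosedCell d) (hx : x.1.1 i = 0) :
    ∃ y : (cyclicType udir (τ.trans (Equiv.swap i j)) Q).ClosedCell d,
      PlanarModuli.ofClosedCell x = PlanarModuli.ofClosedCell y := by
  have hdir : ∀ e : Fin (M + 1), x.1.1 e ≠ 0 →
      edgeDir udir (τ.trans (Equiv.swap i j)) Q e = edgeDir udir τ Q e := fun e he =>
    edgeDir_swap udir τ Q hij (by rintro rfl; exact he hx)
  let y : (cyclicType udir (τ.trans (Equiv.swap i j)) Q).ClosedCell d :=
    ⟨(x.1.1, x.1.2), x.2.1, fun (e : Fin (M + 1)) => by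
      by_cases he : x.1.1 e = 0
      · have := x.2.2.1 e
        rw [he, zero_smul] at this
        change x.1.2 (e + 1 : Fin (M + 1)) = x.1.2 e + x.1.1 e • _
        rw [he, zero_smul]
        exact this
      · have := x.2.2.1 e
        change x.1.2 (e + 1 : Fin (M + 1)) = x.1.2 e + x.1.1 e •
          toPlane (edgeDir udir (τ.trans (Equiv.swap i j)) Q e)
        rw [hdir e he]
        exact this,
      isTropical_contract_cyclicType h _ Q x.exists_len_ne_zero⟩
  have hj : i + 1 = j := by
    have hi : i < Fin.last M := by
      rw [Fin.lt_def, Fin.val_last]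
      have := j.2
      omega
    exact Fin.ext (by rw [Fin.val_add_one_of_lt hi, hij])
  have hclass : Quotient.mk ((cyclicType udir τ Q).contractSetoid x.1.1) i = Quotient.mk _ j := by
    rw [← hj]
    exact contract_mk_eq (T := cyclicType udir τ Q) (e := i) hx
  have hfoot : ∀ w, (Quotient.mk ((cyclicType udir τ Q).contractSetoid x.1.1)
      ((τ.trans (Equiv.swap i j)) w : Fin (M + 1))) = Quotient.mk _ (τ w : Fin (M + 1)) := by
    intro w
    rw [Equiv.trans_apply, Equiv.swap_apply_def]
    split_ifs with h₁ h₂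
    · rw [h₁]
      exact hclass.symm
    · rw [h₂]
      exact hclass
    · rfl
  refine ⟨y, ofClosedCell_eq_mk x (PlanarCurve.ofClosedCell y) (Quotient.mk _)
    Quotient.mk_surjective (fun e he => contract_mk_eq he) (fun v w hvw => Quotient.exact hvw)
    (Equiv.refl _) (Equiv.refl _) (fun e => Or.inl ⟨rfl, rfl, hdir e.1 e.2⟩)
    (fun u => hfoot (Sum.inl u)) (fun _ => rfl) (fun k => hfoot (Sum.inr k)) (fun _ => rfl)
    fun _ => rfl⟩

end PlanarModuli

/-! ### Cyclic curves as degenerate cycles -/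

namespace PlanarType

variable {d n L : ℕ}

/-- Flags on a cycle: the bounded flags at the `i`-th vertex belong to the `i`-th edge, with
weight `α i`, and to the edge before it, with weight `β (i - 1)`. -/
theorem flagSum_cycle {A : Type*} [AddCommMonoid A] {T : PlanarType n} [DecidableEq T.V]
    (f : Fin (L + 1) ≃ T.V) (g : Fin (L + 1) ≃ T.E) {a b : T.E → A} (c : T.U → A)
    (k : Fin n → A) {α β : Fin (L + 1) → A}
    (h : ∀ j,
      (T.tail (g j) = f j ∧ T.head (g j) = f (j + 1) ∧ a (g j) = α j ∧ b (g j) = β j) ∨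
      (T.tail (g j) = f (j + 1) ∧ T.head (g j) = f j ∧ a (g j) = β j ∧ b (g j) = α j))
    (i : Fin (L + 1)) :
    T.flagSum a b c k (f i) = α i + β (i - 1) +
      ∑ w with f.symm (Sum.elim T.foot T.mark w) = i, Sum.elim c k w := by
  rw [flagSum_eq, add_assoc]
  congr 1
  · rw [Finset.sum_filter, Finset.sum_filter, ← Finset.sum_add_distrib, ← Equiv.sum_comp g]
    have hj : ∀ j, ((if T.tail (g j) = f i then a (g j) else 0) +
        if T.head (g j) = f i then b (g j) else 0) =
        (if j = i then α j else 0) + if j = i - 1 then β j else 0 := by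
      intro j
      have h₁ : f j = f i ↔ j = i := f.injective.eq_iff
      have h₂ : f (j + 1) = f i ↔ j = i - 1 := f.injective.eq_iff.trans eq_sub_iff_add_eq.symm
      rcases h j with ⟨h₃, h₄, h₅, h₆⟩ | ⟨h₃, h₄, h₅, h₆⟩
      · simp only [h₃, h₄, h₅, h₆, h₁, h₂]
      · simp only [h₃, h₄, h₅, h₆, h₁, h₂]
        rw [add_comm]
    simp only [hj, Finset.sum_add_distrib, Finset.sum_ite_eq', Finset.mem_univ, if_true]
  · rw [Finset.sum_filter, Finset.sum_filter, Finset.sum_filter, Fintype.sum_sum_type]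
    simp only [Sum.elim_inl, Sum.elim_inr, Equiv.symm_apply_eq]

end PlanarType

namespace PlanarModuli

open PlanarType

variable {d n : ℕ}

/-- A curve whose bounded edges form a cycle is a degeneration of a cycle with one unbounded edge
at each vertex: spread the unbounded edges at each vertex along edges of length `0`. -/
theorem exists_cyclicType (D : PlanarCurve d n) (hD : D.type.IsCycle) :
    ∃ (M : ℕ) (τ : D.type.U ⊕ Fin n ≃ Fin (M + 1)) (Q : ℤ × ℤ)
      (x : (cyclicType D.type.udir τ Q).ClosedCell d), PlanarModuli.ofClosedCell x = mk D := by
  classical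
  obtain ⟨L, f, g, hfg⟩ := hD
  have hu : ∀ j, ∃ v,
      (D.type.tail (g j) = f j ∧ D.type.head (g j) = f (j + 1) ∧ D.type.dir (g j) = v) ∨
      (D.type.tail (g j) = f (j + 1) ∧ D.type.head (g j) = f j ∧ D.type.dir (g j) = -v) := by
    intro j
    rcases hfg j with ⟨h₁, h₂⟩ | ⟨h₁, h₂⟩
    · exact ⟨_, Or.inl ⟨h₁, h₂, rfl⟩⟩
    · exact ⟨_, Or.inr ⟨h₁, h₂, (neg_neg _).symm⟩⟩
  choose u hu using hu
  let blk : D.type.U ⊕ Fin n → Fin (L + 1) :=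
    fun w => f.symm (Sum.elim D.type.foot D.type.mark w)
  have hblk : Function.Surjective blk := by
    intro i
    have h3 := D.isTropical.three_le_valence (f i)
    rw [valence_eq_flagSum, flagSum_cycle f g (α := fun _ => 1) (β := fun _ => 1)] at h3
    · by_contra! hne
      rw [Finset.filter_false_of_mem fun w _ => hne w] at h3
      simp at h3
    · intro j
      rcases hfg j with ⟨h₁, h₂⟩ | ⟨h₁, h₂⟩
      · exact Or.inl ⟨h₁, h₂, rfl, rfl⟩
      · exact Or.inr ⟨h₁, h₂, rfl, rfl⟩
  have hbal : ∀ i, u i - u (i - 1) + ∑ w with blk w = i, endDir n D.type.udir w = 0 := by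
    intro i
    have hb := (isBalanced_iff _).mp D.isTropical.balanced (f i)
    rw [flagSum_cycle f g (α := u) (β := fun j => -u j)] at hb
    · rw [sub_eq_add_neg]
      exact hb
    · intro j
      rcases hu j with ⟨h₁, h₂, h₃⟩ | ⟨h₁, h₂, h₃⟩
      · exact Or.inl ⟨h₁, h₂, h₃, by rw [h₃]⟩
      · exact Or.inr ⟨h₁, h₂, h₃, by rw [h₃, neg_neg]⟩
  have husum : ∀ i, u i = u (Fin.last L) -
      ∑ w with blk w ≤ i, endDir n D.type.udir w := by
    intro i
    induction i using Fin.induction with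
    | zero =>
      have h := hbal 0
      have h₁ : (0 : Fin (L + 1)) - 1 = Fin.last L := by
        rw [sub_eq_iff_eq_add, Fin.last_add_one]
      have h₂ : ∀ w, blk w ≤ 0 ↔ blk w = 0 := fun w => Fin.le_zero_iff
      rw [h₁] at h
      simp only [h₂]
      rw [eq_sub_iff_add_eq, ← sub_eq_zero, ← h]
      abel
    | succ i ih =>
      have h := hbal i.succ
      have h₁ : i.succ - 1 = i.castSucc := by
        rw [sub_eq_iff_eq_add, Fin.coeSucc_eq_succ]
      have h₂ : (Finset.univ.filter fun w => blk w ≤ i.succ) =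
          (Finset.univ.filter fun w => blk w ≤ i.castSucc) ∪
            Finset.univ.filter fun w => blk w = i.succ := by
        ext w
        simp only [Finset.mem_filter, Finset.mem_univ, true_and, Finset.mem_union, Fin.le_def,
          Fin.ext_iff, Fin.val_succ, Fin.val_castSucc]
        omega
      rw [h₁] at h
      rw [h₂, Finset.sum_union, ← sub_sub, ← ih, eq_sub_iff_add_eq, ← sub_eq_zero, ← h]
      · abel
      · rw [Finset.disjoint_filter]
        intro w _ hw
        simp only [Fin.le_def, Fin.ext_iff, Fin.val_succ, Fin.val_castSucc] at *
        omega
  obtain ⟨M, hM⟩ : ∃ M, Fintype.card (D.type.U ⊕ Fin n) = M + 1 := by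
    obtain ⟨w, -⟩ := hblk 0
    exact Nat.exists_eq_succ_of_ne_zero (Fintype.card_pos_iff.mpr ⟨w⟩).ne'
  let τ₀ := Fintype.equivFinOfCardEq hM
  let τ : D.type.U ⊕ Fin n ≃ Fin (M + 1) :=
    τ₀.trans (Tuple.sort fun m => blk (τ₀.symm m)).symm
  let b : Fin (M + 1) → Fin (L + 1) := fun m => blk (τ.symm m)
  have hbτ : ∀ w, b (τ w) = blk w := fun w => by simp [b]
  have hmono : Monotone b := Tuple.monotone_sort fun m => blk (τ₀.symm m)
  have hbs : Function.Surjective b := hblk.comp τ.symm.surjective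
  -- The edges of positive length are those behind the last unbounded edge of each vertex.
  let last : Fin (M + 1) → Prop := fun m => ∀ m', m < m' → b m' ≠ b m
  have hstep : ∀ m, ¬ last m → b (m + 1) = b m := by
    intro m hm
    simp only [last, not_forall, not_not] at hm
    obtain ⟨m', hlt, hb⟩ := hm
    have h1 := Fin.val_add_one_of_lt (lt_of_lt_of_le hlt (Fin.le_last _))
    refine le_antisymm ?_ (hmono ?_)
    · rw [← hb]
      refine hmono ?_
      rw [Fin.le_def, h1]
      exact hlt
    · rw [Fin.le_def, h1]
      omega
  have hjump : ∀ m, last m → b (m + 1) = b m + 1 := by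
    intro m hm
    rcases eq_or_lt_of_le (Fin.le_last m) with rfl | hlt
    · obtain ⟨m₀, h₀⟩ := hbs 0
      obtain ⟨m₁, h₁⟩ := hbs (Fin.last L)
      have h0 : b 0 = 0 := Fin.le_zero_iff.mp (h₀ ▸ hmono (Fin.zero_le m₀))
      have h1 : b (Fin.last M) = Fin.last L :=
        Fin.last_le_iff.mp (h₁ ▸ hmono (Fin.le_last m₁))
      rw [Fin.last_add_one, h0, h1, Fin.last_add_one]
    · have h1 := Fin.val_add_one_of_lt hlt
      have hm1 : m < m + 1 := by rw [Fin.lt_def, h1]; omega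
      have hb : b m < b (m + 1) := lt_of_le_of_ne (hmono hm1.le) (hm _ hm1).symm
      have hb1 := Fin.val_add_one_of_lt (lt_of_lt_of_le hb (Fin.le_last _))
      refine le_antisymm ?_ ?_
      · obtain ⟨m₀, h₀⟩ := hbs (b m + 1)
        rw [← h₀]
        refine hmono ?_
        by_contra! hlt'
        have : m₀ ≤ m := by rw [Fin.lt_def, h1] at hlt'; rw [Fin.le_def]; omega
        have := hmono this
        rw [h₀, Fin.le_def, hb1] at this
        omega
      · rw [Fin.le_def, hb1]
        exact hb
  let len : Fin (M + 1) → ℝ := fun m => if last m then D.len (g (b m)) else 0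
  have hlen : ∀ m, len m ≠ 0 ↔ last m := by
    intro m
    by_cases hm : last m
    · simp only [len, if_pos hm, hm, iff_true]
      exact (D.len_pos _).ne'
    · simp only [len, if_neg hm, hm, ne_eq, not_true]
  have hdir : ∀ m, last m → edgeDir D.type.udir τ (u (Fin.last L)) m = u (b m) := by
    intro m hm
    rw [husum (b m), edgeDir]
    congr 1
    refine Finset.sum_congr ?_ fun _ _ => rfl
    ext w
    simp only [Finset.mem_filter, Finset.mem_univ, true_and]
    rw [← hbτ]
    refine ⟨fun h => hmono h, fun h => ?_⟩
    by_contra! hlt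
    exact hm _ hlt (le_antisymm h (hmono hlt.le))
  have hdeg : HasDegree D.type.udir d := D.isTropical.degree_eq
  let x : (cyclicType D.type.udir τ (u (Fin.last L))).ClosedCell d :=
    ⟨(len, fun m => D.pos (f (b m))), by
      refine ⟨fun m => ?_, fun (m : Fin (M + 1)) => ?_,
        isTropical_contract_cyclicType hdeg _ _ ⟨Fin.last M, ?_⟩⟩
      · dsimp only [len]
        split_ifs
        exacts [(D.len_pos _).le, le_rfl]
      · change D.pos (f (b (m + 1))) = D.pos (f (b m)) +
          len m • toPlane (edgeDir D.type.udir τ (u (Fin.last L)) m)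
        by_cases hm : last m
        · rw [hjump m hm, hdir m hm]
          simp only [len, if_pos hm]
          have hc : D.pos (D.type.head (g (b m))) = D.pos (D.type.tail (g (b m))) +
            D.len (g (b m)) • toPlane (D.type.dir (g (b m))) := D.compatible (g (b m))
          rcases hu (b m) with ⟨h₁, h₂, h₃⟩ | ⟨h₁, h₂, h₃⟩
          · rw [h₁, h₂, h₃] at hc
            exact hc
          · rw [h₁, h₂, h₃, map_neg, smul_neg] at hc
            rw [hc]
            abel
        · simp only [len, if_neg hm, hstep m hm, zero_smul, add_zero]
      · rw [hlen]
        exact fun m' hm' => absurd hm' (not_lt.mpr (Fin.le_last m'))⟩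
  have hψ : Function.Bijective fun m : {m : Fin (M + 1) // len m ≠ 0} => g (b m.1) := by
    constructor
    · rintro ⟨m, hm⟩ ⟨m', hm'⟩ h
      rw [hlen] at hm hm'
      have hb := g.injective h
      rcases lt_trichotomy m m' with hlt | heq | hlt
      · exact absurd hb.symm (hm _ hlt)
      · exact Subtype.ext heq
      · exact absurd hb (hm' _ hlt)
    · intro e
      obtain ⟨m₀, h₀⟩ := hbs (g.symm e)
      obtain ⟨m, hm, hmax⟩ := Finset.exists_max_image
        (Finset.univ.filter fun m => b m = g.symm e) id ⟨m₀, by simp [h₀]⟩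
      simp only [Finset.mem_filter, Finset.mem_univ, true_and, id] at hm hmax
      refine ⟨⟨m, (hlen m).mpr fun m' hlt hb => ?_⟩, by simp [hm]⟩
      exact absurd hlt (not_lt.mpr (hmax m' (hb.trans hm)))
  have hclass : ∀ (j : ℕ) (v w : Fin (M + 1)), (v : ℕ) + j = w → b v = b w →
      (cyclicType D.type.udir τ (u (Fin.last L))).contractSetoid len v w := by
    intro j
    induction j with
    | zero =>
      intro v w hvw _
      rw [Fin.ext (show (v : ℕ) = w from hvw)]
      exact Setoid.refl' _ _
    | succ j ih =>
      intro v w hvw hb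
      have hlt : v < w := by rw [Fin.lt_def]; omega
      have hl : ¬ last v := fun h => h w hlt hb.symm
      have h1 := Fin.val_add_one_of_lt (lt_of_lt_of_le hlt (Fin.le_last _))
      have h2 : ((v + 1 : Fin (M + 1)) : ℕ) + j = w := by
        rw [h1]
        omega
      refine Setoid.trans' _ (Quotient.exact (contract_mk_eq
        (T := cyclicType D.type.udir τ (u (Fin.last L))) (len := len) (e := v) ?_))
        (ih (v + 1) w h2 ((hstep v hl).trans hb))
      exact not_not.mp fun h => hl ((hlen v).mp h)
  refine ⟨M, τ, u (Fin.last L), x, ofClosedCell_eq_mk x D (fun m => f (b m))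
    (f.surjective.comp hbs) (fun (m : Fin (M + 1)) hm => ?_)
    (fun (v w : Fin (M + 1)) hvw => ?_) (Equiv.ofBijective _ hψ)
    (Equiv.refl _) (fun m => ?_) (fun w => ?_) (fun _ => rfl) (fun i => ?_) (fun m => ?_)
    fun _ => rfl⟩
  · change f (b m) = f (b (m + 1 : Fin (M + 1)))
    rw [hstep m fun h => (hlen m).mpr h hm]
  · have hb := f.injective hvw
    rcases le_total v w with h | h
    · exact hclass _ v w (Nat.add_sub_of_le h) hb
    · exact Setoid.symm' _ (hclass _ w v (Nat.add_sub_of_le h) hb.symm)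
  · obtain ⟨(m : Fin (M + 1)), hm⟩ := m
    replace hm := (hlen m).mp hm
    change (D.type.tail (g (b m)) = f (b m) ∧ D.type.head (g (b m)) = f (b (m + 1)) ∧
      D.type.dir (g (b m)) = edgeDir D.type.udir τ (u (Fin.last L)) m) ∨
      (D.type.tail (g (b m)) = f (b (m + 1)) ∧ D.type.head (g (b m)) = f (b m) ∧
        D.type.dir (g (b m)) = -edgeDir D.type.udir τ (u (Fin.last L)) m)
    rw [hjump _ hm, hdir _ hm]
    exact hu _
  · change D.type.foot w = f (b (τ (Sum.inl w)))
    rw [hbτ]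
    exact (f.apply_symm_apply _).symm
  · change D.type.mark i = f (b (τ (Sum.inr i)))
    rw [hbτ]
    exact (f.apply_symm_apply _).symm
  · change D.len (g (b m.1)) = len m.1
    simp only [len, if_pos ((hlen m.1).mp m.2)]

end PlanarModuli

/-! ### The curve with a contracted loop -/

namespace PlanarType

variable {d n : ℕ} {U : Type} [Fintype U]

/-- The type with a single vertex and a single bounded edge, a loop of direction `0`. -/
def loopType (n : ℕ) (udir : U → ℤ × ℤ) : PlanarType n where
  V := Unit
  E := Unit
  U := U
  tail _ := ()
  head _ := ()
  dir _ := 0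
  foot _ := ()
  udir := udir
  mark _ := ()

theorem flagSum_loopType {A : Type*} [AddCommMonoid A] (udir : U → ℤ × ℤ) (a b : Unit → A)
    (c : U → A) (k : Fin n → A) (v : Unit) :
    (loopType n udir).flagSum a b c k v = a () + b () + ∑ u, c u + ∑ i, k i := by
  have h := @flagSum_eq n A _ (loopType n udir) (inferInstanceAs (DecidableEq Unit)) a b c k v
  refine h.trans ?_
  change (∑ e : Unit with () = v, a e) + (∑ e : Unit with () = v, b e)
    + (∑ u with () = v, c u) + (∑ i with () = v, k i) = _
  simp

theorem isTropical_loopType {udir : U → ℤ × ℤ} (h : HasDegree udir d) (hd : 1 ≤ d) :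
    (loopType n udir).IsTropical 1 d where
  connected := ⟨⟨()⟩, fun _ _ => Relation.EqvGen.refl _⟩
  three_le_valence v := by
    rw [valence_eq_flagSum]
    erw [flagSum_loopType]
    have := h.card
    simp only [Finset.sum_const, Finset.card_univ, smul_eq_mul, mul_one]
    omega
  balanced := by
    rw [isBalanced_iff]
    intro v
    erw [flagSum_loopType]
    simp [loopType, h.sum_eq_zero]
  genus_eq := by
    change 1 + (Fintype.card Unit : ℤ) - (Fintype.card Unit : ℤ) = 1
    ring
  degree_eq := h

/-- The curve at the origin whose only bounded edge is a loop of length `1` and direction `0`. -/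
def loopCurve (n : ℕ) {udir : U → ℤ × ℤ} (h : HasDegree udir d) (hd : 1 ≤ d) :
    PlanarCurve d n where
  type := loopType n udir
  isTropical := isTropical_loopType h hd
  len _ := 1
  len_pos _ := one_pos
  pos _ := 0
  compatible e := by
    change (0 : ℝ × ℝ) = 0 + (1 : ℝ) • toPlane 0
    simp

end PlanarType

namespace PlanarModuli

open PlanarType

variable {d n M : ℕ} {U : Type} [Fintype U]

/-- Any two families of unbounded edges of degree `d` are in bijection. -/
theorem mk_loopCurve_eq {U' : Type} [Fintype U'] {udir : U → ℤ × ℤ} {udir' : U' → ℤ × ℤ}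
    (h : HasDegree udir d) (h' : HasDegree udir' d) (hd : 1 ≤ d) :
    mk (loopCurve n h hd) = mk (loopCurve n h' hd) := by
  classical
  have hfib : ∀ c, Nonempty ({u // udir u = c} ≃ {u // udir' u = c}) := by
    intro c
    refine ⟨Fintype.equivOfCardEq ?_⟩
    have := congrArg (Multiset.count c) (Eq.trans h h'.symm)
    rw [Multiset.count_map, Multiset.count_map] at this
    rw [Fintype.card_subtype, Fintype.card_subtype, Finset.card_def, Finset.card_def,
      Finset.filter_val, Finset.filter_val]
    simpa only [eq_comm] using this
  let e : U ≃ U' := Equiv.ofFiberEquiv fun c => (hfib c).some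
  exact Quotient.sound ⟨
    { onV := Equiv.refl Unit
      onE := Equiv.refl Unit
      onU := e
      edge := fun _ => Or.inl ⟨rfl, rfl, rfl⟩
      foot := fun _ => rfl
      udir := fun u => Equiv.ofFiberEquiv_map _ u
      mark := fun _ => rfl
      len := fun _ => rfl
      pos := fun _ => rfl }⟩

/-- If an edge of the cycle has direction `0`, then all other edges can be contracted. -/
theorem exists_ofClosedCell_eq_loopCurve {udir : U → ℤ × ℤ} (h : HasDegree udir d) (hd : 1 ≤ d)
    {τ : U ⊕ Fin n ≃ Fin (M + 1)} {Q : ℤ × ℤ} {t : Fin (M + 1)} (ht : edgeDir udir τ Q t = 0) :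
    ∃ x : (cyclicType udir τ Q).ClosedCell d,
      PlanarModuli.ofClosedCell x = mk (loopCurve n h hd) := by
  let len : Fin (M + 1) → ℝ := Pi.single t 1
  have hlen : ∀ m, len m ≠ 0 ↔ m = t := by
    intro m
    by_cases hm : m = t
    · simp [len, hm]
    · simp [len, hm]
  let x : (cyclicType udir τ Q).ClosedCell d := ⟨(len, fun _ => 0), by
    refine ⟨fun (m : Fin (M + 1)) => ?_, fun (m : Fin (M + 1)) => ?_,
      isTropical_contract_cyclicType h τ Q ⟨t, (hlen t).mpr rfl⟩⟩
    · by_cases hm : m = t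
      · simp [len, hm]
      · simp [len, Pi.single_eq_of_ne hm]
    · change (0 : ℝ × ℝ) = 0 + len m • toPlane (edgeDir udir τ Q m)
      by_cases hm : m = t
      · rw [hm, ht, map_zero, smul_zero, add_zero]
      · simp [len, Pi.single_eq_of_ne hm]⟩
  have hcard : Nat.card ((cyclicType udir τ Q).contract len).V = 1 := by
    have hg := x.2.2.2.genus_eq
    rw [genus_eq_natCard] at hg
    have hE : Nat.card ((cyclicType udir τ Q).contract len).E = 1 := by
      have : Unique ((cyclicType udir τ Q).contract len).E :=
        { default := ⟨t, (hlen t).mpr rfl⟩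
          uniq := fun e => Subtype.ext ((hlen _).mp e.2) }
      exact Nat.card_unique
    change 1 + (Nat.card ((cyclicType udir τ Q).contract len).E : ℤ) -
      (Nat.card ((cyclicType udir τ Q).contract len).V : ℤ) = 1 at hg
    omega
  have hdir : ∀ e : {e // x.1.1 e ≠ 0}, edgeDir udir τ Q e.1 = 0 := fun e => by
    rw [(hlen e.1).mp e.2, ht]
  refine ⟨x, ofClosedCell_eq_mk x (loopCurve n h hd) (fun _ => ()) (fun _ => ⟨t, rfl⟩)
    (fun _ _ => rfl) (fun v w _ => ?_)
    { toFun := fun _ => (), invFun := fun _ => ⟨t, (hlen t).mpr rfl⟩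
      left_inv := fun e => Subtype.ext ((hlen _).mp e.2).symm, right_inv := fun _ => rfl }
    (Equiv.refl _) (fun e => Or.inl ⟨rfl, rfl, (hdir e).symm⟩) (fun _ => rfl) (fun _ => rfl)
    (fun _ => rfl) (fun e => ?_) (fun _ => rfl)⟩
  · have := (Nat.card_eq_one_iff_unique.mp hcard).1
    exact Quotient.exact (Subsingleton.elim (α := ((cyclicType udir τ Q).contract len).V)
      (Quotient.mk _ v) (Quotient.mk _ w))
  · change (1 : ℝ) = len e.1
    rw [(hlen e.1).mp e.2]
    simp [len]

end PlanarModuli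

/-! ### Positive relations in the plane -/

/-- Carathéodory's exchange step in the plane: among four or more vectors with a nonnegative
relation, one can be dispensed with, and any prescribed one of them can be kept. -/
theorem exists_nonneg_relation_erase {ι : Type*} [Fintype ι] [DecidableEq ι] (v : ι → ℝ × ℝ)
    {l : ι → ℝ} (hl : ∀ i, 0 ≤ l i) (hne : ∃ i, l i ≠ 0) (hsum : ∑ i, l i • v i = 0)
    {R : Finset ι} (hR : ∀ i, l i ≠ 0 → i ∈ R) (hcard : 4 ≤ R.card) (m : ι) :
    ∃ s ∈ R, s ≠ m ∧ ∃ l' : ι → ℝ, (∀ i, 0 ≤ l' i) ∧ (∃ i, l' i ≠ 0) ∧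
      ∑ i, l' i • v i = 0 ∧ ∀ i, l' i ≠ 0 → i ∈ R.erase s := by
  have hdep : ∃ c : ι → ℝ, (∀ i, c i ≠ 0 → i ∈ R) ∧ (∃ i, c i ≠ 0) ∧
      ∑ i, c i • v i = 0 ∧ ∑ i, c i = 0 := by
    have hnli : ¬ LinearIndependent ℝ fun i : R => (v i, (1 : ℝ)) := by
      intro h
      have := h.fintype_card_le_finrank
      simp at this
      omega
    obtain ⟨c, hc, i, hi⟩ := Fintype.not_linearIndependent_iff.mp hnli
    have hext : ∀ {E : Type} [AddCommGroup E] [Module ℝ E] (u : ι → E),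
        ∑ i, (if hi : i ∈ R then c ⟨i, hi⟩ else 0) • u i = ∑ i : R, c i • u i := by
      intro E _ _ u
      rw [← Finset.sum_subset (Finset.subset_univ R), ← Finset.sum_coe_sort]
      · exact Finset.sum_congr rfl fun j _ => by simp
      · intro j _ hj
        simp [hj]
    refine ⟨fun i => if hi : i ∈ R then c ⟨i, hi⟩ else 0, fun i hi => ?_, ⟨i, ?_⟩, ?_, ?_⟩
    · by_contra h
      exact hi (dif_neg h)
    · simpa using hi
    · rw [hext v]
      simpa [Prod.fst_sum] using congrArg Prod.fst hc
    · have := hext fun _ => (1 : ℝ)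
      simp only [smul_eq_mul, mul_one] at this
      rw [this]
      simpa [Prod.snd_sum] using congrArg Prod.snd hc
  have hdep' : ∃ c : ι → ℝ, (∀ i, c i ≠ 0 → i ∈ R) ∧ (∃ i, c i ≠ 0) ∧
      ∑ i, c i • v i = 0 ∧ ∑ i, c i = 0 ∧ 0 ≤ c m := by
    obtain ⟨c, h₁, ⟨i, h₂⟩, h₃, h₄⟩ := hdep
    rcases le_total 0 (c m) with h | h
    · exact ⟨c, h₁, ⟨i, h₂⟩, h₃, h₄, h⟩
    · refine ⟨fun i => -c i, fun i hi => h₁ i fun h0 => hi (by simp [h0]), ⟨i, by simpa⟩, ?_, ?_,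
        by simpa⟩
      · simp [h₃]
      · simp [h₄]
  obtain ⟨c, hcR, hc0, hcv, hcs, hcm⟩ := hdep'
  have hneg : (Finset.univ.filter fun i => c i < 0).Nonempty := by
    by_contra hemp
    have hall : ∀ i, 0 ≤ c i := by
      intro i
      by_contra! h
      exact hemp ⟨i, by simp [h]⟩
    obtain ⟨i, hi⟩ := hc0
    exact hi ((Finset.sum_eq_zero_iff_of_nonneg fun i _ => hall i).mp hcs i (Finset.mem_univ i))
  -- Move along `c` until the first length vanishes.
  obtain ⟨s, hs, hmin⟩ := Finset.exists_min_image _ (fun i => l i / (-c i)) hneg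
  simp only [Finset.mem_filter, Finset.mem_univ, true_and] at hs hmin
  have hs0 : l s + l s / (-c s) * c s = 0 := by
    have : c s ≠ 0 := hs.ne
    field_simp
    ring
  have hε : 0 ≤ l s / (-c s) := div_nonneg (hl s) (by linarith)
  refine ⟨s, hcR s hs.ne, fun h => ?_, fun i => l i + l s / (-c s) * c i, fun i => ?_, ?_, ?_,
    fun i hi => ?_⟩
  · rw [h] at hs
    linarith
  · rcases le_or_gt 0 (c i) with h | h
    · exact add_nonneg (hl i) (mul_nonneg hε h)
    · have h₁ := hmin i h
      rw [le_div_iff₀ (by linarith)] at h₁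
      linarith
  · by_contra! h
    have h₁ : ∑ i, (l i + l s / (-c s) * c i) = ∑ i, l i := by
      rw [Finset.sum_add_distrib, ← Finset.mul_sum, hcs]
      ring
    rw [Finset.sum_eq_zero fun i _ => h i] at h₁
    obtain ⟨i, hi⟩ := hne
    exact hi ((Finset.sum_eq_zero_iff_of_nonneg fun i _ => hl i).mp h₁.symm i (Finset.mem_univ i))
  · simp only [add_smul, mul_smul, Finset.sum_add_distrib, ← Finset.smul_sum, hcv, hsum]
    simp
  · rw [Finset.mem_erase]
    refine ⟨fun h => hi (by rw [h]; exact hs0), ?_⟩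
    by_contra h
    have h₁ : l i = 0 := not_not.mp fun h0 => h (hR i h0)
    have h₂ : c i = 0 := not_not.mp fun h0 => h (hcR i h0)
    refine hi ?_
    dsimp only
    rw [h₁, h₂]
    ring

namespace PlanarType

/-- Every lattice point of the zonotope spanned by copies of `(1,1)`, `(-1,0)`, `(0,-1)` is the
sum of some of these copies. Since `(1,1) + (-1,0) + (0,-1) = 0`, one may round down the three
coefficients of the point: they have the same fractional part. -/
theorem exists_subset_sum_eq {W : Type*} [DecidableEq W] (D : Finset W) (δ : W → ℤ × ℤ)
    (hδ : ∀ w ∈ D, δ w = 0 ∨ δ w = (1, 1) ∨ δ w = (-1, 0) ∨ δ w = (0, -1)) (t : W → ℝ)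
    (ht0 : ∀ w ∈ D, 0 ≤ t w) (ht1 : ∀ w ∈ D, t w ≤ 1) (q : ℤ × ℤ)
    (hq : toPlane q = ∑ w ∈ D, t w • toPlane (δ w)) :
    ∃ A ⊆ D, q = ∑ w ∈ A, δ w := by
  let s : ℤ × ℤ → ℝ := fun a => ∑ w ∈ D with δ w = a, t w
  have hs0 : ∀ a, 0 ≤ s a := fun a =>
    Finset.sum_nonneg fun w hw => ht0 w (Finset.mem_filter.mp hw).1
  have hs1 : ∀ a, s a ≤ (D.filter fun w => δ w = a).card := fun a =>
    (Finset.sum_le_card_nsmul _ _ 1 fun w hw => ht1 w (Finset.mem_filter.mp hw).1).trans_eq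
      (by simp)
  have hsplit : ∑ w ∈ D, t w • toPlane (δ w) =
      (s (1, 1) - s (-1, 0), s (1, 1) - s (0, -1)) := by
    simp only [s, Finset.sum_filter, ← Finset.sum_sub_distrib]
    rw [← Finset.sum_congr rfl fun w hw => ?_]
    · exact Prod.ext (Prod.fst_sum (f := fun w => (_, _))) (Prod.snd_sum (f := fun w => (_, _)))
    · rcases hδ w hw with h | h | h | h <;> simp [h, toPlane_apply, Prod.ext_iff]
  rw [hsplit, toPlane_apply, Prod.mk.injEq] at hq
  have hsub : ∀ a, ∃ B ⊆ D.filter fun w => δ w = a, B.card = ⌊s a⌋₊ := fun a =>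
    Finset.exists_subset_card_eq (by exact_mod_cast (Nat.floor_le (hs0 a)).trans (hs1 a))
  choose B hB hBc using hsub
  have hBδ : ∀ a, ∀ w ∈ B a, δ w = a := fun a w hw => (Finset.mem_filter.mp (hB a hw)).2
  have hdisj : ∀ a b, a ≠ b → Disjoint (B a) (B b) := fun a b hab =>
    Finset.disjoint_left.mpr fun w ha hb => hab ((hBδ a w ha).symm.trans (hBδ b w hb))
  have hBs : ∀ a, ∑ w ∈ B a, δ w = (⌊s a⌋ : ℤ) • a := by
    intro a
    rw [Finset.sum_congr rfl (hBδ a), Finset.sum_const, hBc, ← natCast_zsmul,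
      Int.natCast_floor_eq_floor (hs0 a)]
  have h₁ : ⌊s (-1, 0)⌋ = ⌊s (1, 1)⌋ - q.1 := by
    rw [← Int.floor_sub_intCast, hq.1]
    congr 1
    ring
  have h₂ : ⌊s (0, -1)⌋ = ⌊s (1, 1)⌋ - q.2 := by
    rw [← Int.floor_sub_intCast, hq.2]
    congr 1
    ring
  refine ⟨B (1, 1) ∪ (B (-1, 0) ∪ B (0, -1)), ?_, ?_⟩
  · refine Finset.union_subset ?_ (Finset.union_subset ?_ ?_) <;>
      exact (hB _).trans (Finset.filter_subset _ _)
  · rw [Finset.sum_union, Finset.sum_union, hBs, hBs, hBs, h₁, h₂]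
    · ext <;> simp
    · exact hdisj _ _ (by decide)
    · exact Finset.disjoint_union_right.mpr ⟨hdisj _ _ (by decide), hdisj _ _ (by decide)⟩

/-! ### Reordering the unbounded edges -/

variable {d n M : ℕ} {U : Type} [Fintype U] {udir : U → ℤ × ℤ}
  {τ : U ⊕ Fin n ≃ Fin (M + 1)} {Q : ℤ × ℤ}

theorem HasDegree.endDir_mem (h : HasDegree udir d) (w : U ⊕ Fin n) :
    endDir n udir w = 0 ∨ endDir n udir w = (1, 1) ∨ endDir n udir w = (-1, 0) ∨
      endDir n udir w = (0, -1) := by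
  cases w with
  | inl u => exact Or.inr (h.mem u)
  | inr i => exact Or.inl rfl

open scoped Classical in
theorem edgeDir_sub (udir : U → ℤ × ℤ) (τ : U ⊕ Fin n ≃ Fin (M + 1)) (Q : ℤ × ℤ)
    {i m : Fin (M + 1)} (him : i ≤ m) :
    edgeDir udir τ Q m = edgeDir udir τ Q i - ∑ w with i < τ w ∧ τ w ≤ m, endDir n udir w := by
  rw [edgeDir, edgeDir, sub_sub]
  congr 1
  have : (Finset.univ.filter fun w => τ w ≤ m) = (Finset.univ.filter fun w => τ w ≤ i) ∪
      Finset.univ.filter fun w => i < τ w ∧ τ w ≤ m := by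
    ext w
    simp only [Finset.mem_filter, Finset.mem_univ, true_and, Finset.mem_union, Fin.le_def,
      Fin.lt_def] at *
    omega
  rw [this, Finset.sum_union]
  rw [Finset.disjoint_filter]
  exact fun w _ h h' => absurd h (not_le.mpr h'.1)

/-- If the edges between the `i`-th and the `k`-th admit a relation, then the direction of the
`i`-th edge is the sum of some of the unbounded edges in between. Ordering these first produces
an edge of direction `0`. -/
theorem IsRelation.exists_edgeDir_eq (h : HasDegree udir d) {l : Fin (M + 1) → ℝ}
    (hl : IsRelation udir τ Q l) {i k : Fin (M + 1)} (hsupp : ∀ m, l m ≠ 0 → i ≤ m ∧ m ≤ k) :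
    ∃ A : Finset (U ⊕ Fin n), (∀ w ∈ A, i < τ w ∧ τ w ≤ k) ∧
      edgeDir udir τ Q i = ∑ w ∈ A, endDir n udir w := by
  classical
  have hS : 0 < ∑ m, l m := by
    refine lt_of_le_of_ne (Finset.sum_nonneg fun m _ => hl.nonneg m) fun h0 => ?_
    obtain ⟨m, hm⟩ := hl.exists_ne_zero
    exact hm ((Finset.sum_eq_zero_iff_of_nonneg fun m _ => hl.nonneg m).mp h0.symm m
      (Finset.mem_univ m))
  set S := ∑ m, l m with hSdef
  let D : Finset (U ⊕ Fin n) := Finset.univ.filter fun w => i < τ w ∧ τ w ≤ k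
  have hterm : ∀ m, l m • toPlane (edgeDir udir τ Q m) = l m • toPlane (edgeDir udir τ Q i) -
      ∑ w ∈ D, (if τ w ≤ m then l m else 0) • toPlane (endDir n udir w) := by
    intro m
    by_cases hm : l m = 0
    · simp [hm]
    · obtain ⟨him, hmk⟩ := hsupp m hm
      rw [edgeDir_sub udir τ Q him, map_sub, smul_sub, map_sum, Finset.smul_sum]
      congr 1
      have : (Finset.univ.filter fun w => i < τ w ∧ τ w ≤ m) = D.filter fun w => τ w ≤ m := by
        ext w
        simp only [D, Finset.mem_filter, Finset.mem_univ, true_and]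
        exact ⟨fun h => ⟨⟨h.1, h.2.trans hmk⟩, h.2⟩, fun h => ⟨h.1.1, h.2⟩⟩
      rw [this, Finset.sum_filter]
      refine Finset.sum_congr rfl fun w _ => ?_
      split_ifs <;> simp
  have hrel := hl.sum_eq_zero
  simp only [hterm, Finset.sum_sub_distrib, ← Finset.sum_smul, ← hSdef] at hrel
  rw [Finset.sum_comm, sub_eq_zero] at hrel
  simp only [← Finset.sum_smul] at hrel
  obtain ⟨A, hA, hq⟩ := exists_subset_sum_eq D (endDir n udir) (fun w _ => h.endDir_mem w)
    (fun w => (∑ m, if τ w ≤ m then l m else 0) / S)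
    (fun w _ => div_nonneg (Finset.sum_nonneg fun m _ => by
      split_ifs
      exacts [hl.nonneg m, le_rfl]) hS.le)
    (fun w _ => (div_le_one hS).mpr (Finset.sum_le_sum fun m _ => by
      split_ifs
      exacts [le_rfl, hl.nonneg m]))
    (edgeDir udir τ Q i) (by
      simp only [div_eq_inv_mul, mul_smul, ← Finset.smul_sum]
      rw [← hrel, smul_smul, inv_mul_cancel₀ hS.ne', one_smul])
  exact ⟨A, fun w hw => (Finset.mem_filter.mp (hA hw)).2, hq⟩

/-- A relation can be replaced by one that involves at most three of its edges. -/
theorem IsRelation.exists_card_le_three {l : Fin (M + 1) → ℝ} (hl : IsRelation udir τ Q l)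
    (R : Finset (Fin (M + 1))) (hR : ∀ m, l m ≠ 0 → m ∈ R) :
    ∃ R' ⊆ R, R'.card ≤ 3 ∧ ∃ l', IsRelation udir τ Q l' ∧ ∀ m, l' m ≠ 0 → m ∈ R' := by
  induction hc : R.card using Nat.strong_induction_on generalizing R l with
  | _ c ih =>
    by_cases h3 : c ≤ 3
    · exact ⟨R, subset_rfl, hc.trans_le h3, l, hl, hR⟩
    · obtain ⟨s, hs, -, l', h₁, h₂, h₃, h₄⟩ := exists_nonneg_relation_erase
        (fun m => toPlane (edgeDir udir τ Q m)) hl.nonneg hl.exists_ne_zero hl.sum_eq_zero hR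
        (by omega) 0
      obtain ⟨R', hR', h⟩ := ih _ (hc ▸ Finset.card_erase_lt_of_mem hs) ⟨h₁, h₂, h₃⟩ _ h₄ rfl
      exact ⟨R', hR'.trans (Finset.erase_subset _ _), h⟩

theorem IsRelation.swap {l : Fin (M + 1) → ℝ} (hl : IsRelation udir τ Q l) {i j : Fin (M + 1)}
    (hij : (j : ℕ) = i + 1) (hi : l i = 0) :
    IsRelation udir (τ.trans (Equiv.swap i j)) Q l where
  nonneg := hl.nonneg
  exists_ne_zero := hl.exists_ne_zero
  sum_eq_zero := by
    rw [← hl.sum_eq_zero]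
    refine Finset.sum_congr rfl fun m _ => ?_
    by_cases hm : m = i
    · rw [hm, hi, zero_smul, zero_smul]
    · rw [edgeDir_swap udir τ Q hij hm]

/-- Every curve in the closed cell of the cycle is joined to the curve with a contracted loop. -/
def ReachesLoop (h : HasDegree udir d) (hd : 1 ≤ d) (τ : U ⊕ Fin n ≃ Fin (M + 1))
    (Q : ℤ × ℤ) : Prop :=
  ∀ x : (cyclicType udir τ Q).ClosedCell d,
    Joined (PlanarModuli.ofClosedCell x) (PlanarModuli.mk (loopCurve n h hd))

theorem reachesLoop_of_edgeDir_eq_zero (h : HasDegree udir d) (hd : 1 ≤ d) {t : Fin (M + 1)}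
    (ht : edgeDir udir τ Q t = 0) : ReachesLoop h hd τ Q := by
  intro x
  obtain ⟨y, hy⟩ := PlanarModuli.exists_ofClosedCell_eq_loopCurve h hd ht
  rw [← hy]
  exact PlanarModuli.joined_of_cyclicType h x y

theorem ReachesLoop.of_swap {h : HasDegree udir d} {hd : 1 ≤ d} {i j : Fin (M + 1)}
    (hij : (j : ℕ) = i + 1) (hr : ReachesLoop h hd (τ.trans (Equiv.swap i j)) Q)
    {l : Fin (M + 1) → ℝ} (hl : IsRelation udir τ Q l) (hi : l i = 0) :
    ReachesLoop h hd τ Q := by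
  intro x
  obtain ⟨y, hy⟩ := hl.exists_closedCell h
  obtain ⟨z, hz⟩ := PlanarModuli.exists_ofClosedCell_swap h hij y (by rw [hy]; exact hi)
  refine (PlanarModuli.joined_of_cyclicType h x y).trans ?_
  rw [hz]
  exact hr z

/-- If `A` consists of the first unbounded edges behind the `i`-th edge, and adds up to the
direction of that edge, then some edge has direction `0`. -/
theorem exists_edgeDir_eq_zero_of_initial {A : Finset (U ⊕ Fin n)} {i k : Fin (M + 1)}
    (hA : ∀ w ∈ A, i < τ w ∧ τ w ≤ k)
    (hsum : edgeDir udir τ Q i = ∑ w ∈ A, endDir n udir w)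
    (hinit : ∀ m m' : Fin (M + 1), (m' : ℕ) = m + 1 → i < m → m' ≤ k →
      τ.symm m' ∈ A → τ.symm m ∈ A) :
    ∃ t, edgeDir udir τ Q t = 0 := by
  classical
  rcases A.eq_empty_or_nonempty with rfl | hne
  · exact ⟨i, by simpa using hsum⟩
  · obtain ⟨w₀, hw₀, hmax⟩ := Finset.exists_max_image A τ hne
    have hdown : ∀ (j : ℕ) w, (τ w : ℕ) + j = τ w₀ → i < τ w → w ∈ A := by
      intro j
      induction j with
      | zero =>
        intro w hw _
        have : w = w₀ := τ.injective (Fin.ext hw)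
        rwa [this]
      | succ j ih =>
        intro w hw hi
        have hlt : (τ w : ℕ) + 1 < M + 1 := by
          have := (τ w₀).2
          omega
        have hk := (hA w₀ hw₀).2
        have := hinit (τ w) ⟨τ w + 1, hlt⟩ rfl hi (by rw [Fin.le_def] at *; simp only; omega)
          (ih _ (by simp only [Equiv.apply_symm_apply]; omega) (by
            rw [Equiv.apply_symm_apply]
            rw [Fin.lt_def] at *
            simp only
            omega))
        rwa [Equiv.symm_apply_apply] at this
    refine ⟨τ w₀, ?_⟩
    rw [edgeDir_sub udir τ Q (hA w₀ hw₀).1.le, hsum, sub_eq_zero]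
    refine Finset.sum_congr ?_ fun _ _ => rfl
    ext w
    simp only [Finset.mem_filter, Finset.mem_univ, true_and]
    exact ⟨fun hw => ⟨(hA w hw).1, hmax w hw⟩,
      fun hw => hdown _ w (Nat.add_sub_of_le hw.2) hw.1⟩

/-- Three consecutive edges with a relation, where the last of the two unbounded edges between
them agrees with the direction of the first edge: the triangle of directions contains no lattice
points besides its vertices. -/
theorem exists_eq_zero_of_unimodular {a b c : ℝ} {δ₁ δ₂ : ℤ × ℤ} (ha : 0 ≤ a) (hb : 0 ≤ b)
    (hc : 0 ≤ c) (hne : a + b + c ≠ 0)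
    (h₁ : δ₁ = 0 ∨ δ₁ = (1, 1) ∨ δ₁ = (-1, 0) ∨ δ₁ = (0, -1))
    (h₂ : δ₂ = 0 ∨ δ₂ = (1, 1) ∨ δ₂ = (-1, 0) ∨ δ₂ = (0, -1))
    (hrel : a • toPlane δ₂ + b • toPlane (δ₂ - δ₁) + c • toPlane (-δ₁) = 0) :
    δ₂ = 0 ∨ δ₂ - δ₁ = 0 ∨ -δ₁ = 0 := by
  have hx := congrArg Prod.fst hrel
  have hy := congrArg Prod.snd hrel
  by_contra! hcon
  apply hne
  rcases h₁ with rfl | rfl | rfl | rfl <;> rcases h₂ with rfl | rfl | rfl | rfl <;>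
    first
    | exact absurd rfl hcon.1
    | exact absurd (sub_self _) hcon.2.1
    | exact absurd neg_zero hcon.2.2
    | (simp [toPlane_apply] at hx hy; linarith)

end PlanarType

/-! ### Joining every curve to the one with a contracted loop -/

namespace PlanarType

variable {d n M : ℕ} {U : Type} [Fintype U] {udir : U → ℤ × ℤ} {Q : ℤ × ℤ}

/-- If the edges between the `i`-th and the `k`-th admit a relation, then the curves of the cycle
are joined to the one with a contracted loop. By induction on `k - i` one may assume that no
shorter interval of edges has this property. If `k - i ≥ 3`, then by the exchange step each single
edge strictly inside the interval can be contracted, so that the unbounded edges attached along the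
interval can be reordered freely, and one puts those first that add up to the direction of the
`i`-th edge. -/
theorem reachesLoop_of_support (h : HasDegree udir d) (hd : 1 ≤ d) (s : ℕ) :
    ∀ (τ : U ⊕ Fin n ≃ Fin (M + 1)) (i k : Fin (M + 1)), (k : ℕ) = i + s →
      ∀ l : Fin (M + 1) → ℝ, IsRelation udir τ Q l → (∀ m, l m ≠ 0 → i ≤ m ∧ m ≤ k) →
        ReachesLoop h hd τ Q := by
  classical
  induction s using Nat.strong_induction_on with
  | _ s ih =>
  intro τ i k hk l hl hsupp
  obtain ⟨A, hA, hsum⟩ := hl.exists_edgeDir_eq h hsupp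
  induction hμ : ∑ w ∈ A, (τ w : ℕ) using Nat.strong_induction_on generalizing τ l with
  | _ μ ihμ =>
  by_cases hinit : ∀ m m' : Fin (M + 1), (m' : ℕ) = m + 1 → i < m → m' ≤ k →
      τ.symm m' ∈ A → τ.symm m ∈ A
  · obtain ⟨t, ht⟩ := exists_edgeDir_eq_zero_of_initial hA hsum hinit
    exact reachesLoop_of_edgeDir_eq_zero h hd ht
  push Not at hinit
  obtain ⟨m, m', hmm', him, hmk, hm'A, hmA⟩ := hinit
  have hmk' : m < k := by
    rw [Fin.lt_def, Fin.le_def] at *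
    omega
  have hs : 2 ≤ s := by
    rw [Fin.lt_def] at *
    omega
  -- A shorter interval is covered by the induction hypothesis.
  have hleft : ∀ l', IsRelation udir τ Q l' → (∀ j, l' j ≠ 0 → i ≤ j ∧ j ≤ k) → l' i = 0 →
      ReachesLoop h hd τ Q := by
    intro l' hl' hsupp' h0
    refine ih (s - 1) (by omega) τ ⟨i + 1, by have := k.2; omega⟩ k (by simp only; omega) l' hl'
      fun j hj => ?_
    have hji : (j : ℕ) ≠ i := fun h => hj (by rw [Fin.ext h, h0])
    have := hsupp' j hj
    simp only [Fin.le_def] at *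
    omega
  have hright : ∀ l', IsRelation udir τ Q l' → (∀ j, l' j ≠ 0 → i ≤ j ∧ j ≤ k) → l' k = 0 →
      ReachesLoop h hd τ Q := by
    intro l' hl' hsupp' h0
    refine ih (s - 1) (by omega) τ i ⟨k - 1, by have := k.2; omega⟩ (by simp only; omega) l' hl'
      fun j hj => ?_
    have hjk : (j : ℕ) ≠ k := fun h => hj (by rw [Fin.ext h, h0])
    have := hsupp' j hj
    simp only [Fin.le_def] at *
    omega
  -- If the `m`-th edge can be contracted, then exchange the unbounded edges at its ends.
  have hmid : ∀ l', IsRelation udir τ Q l' → (∀ j, l' j ≠ 0 → i ≤ j ∧ j ≤ k) → l' m = 0 →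
      ReachesLoop h hd τ Q := by
    intro l' hl' hsupp' h0
    have hswap : ∀ w ∈ A, τ w ≠ m' → (τ.trans (Equiv.swap m m')) w = τ w := by
      intro w hw hne
      refine Equiv.swap_apply_of_ne_of_ne (fun h => hmA ?_) hne
      rwa [← h, Equiv.symm_apply_apply]
    have hswap' : ∀ w ∈ A, τ w = m' → (τ.trans (Equiv.swap m m')) w = m := by
      intro w _ hw
      rw [Equiv.trans_apply, hw, Equiv.swap_apply_right]
    refine ReachesLoop.of_swap hmm' (ihμ _ ?_ (τ.trans (Equiv.swap m m')) l' (hl'.swap hmm' h0)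
      hsupp' (fun w hw => ?_) ?_ rfl) hl' h0
    · rw [← hμ]
      refine Finset.sum_lt_sum (fun w hw => ?_) ⟨τ.symm m', hm'A, ?_⟩
      · by_cases hwm : τ w = m'
        · rw [hswap' w hw hwm, hwm]
          omega
        · rw [hswap w hw hwm]
      · rw [hswap' _ hm'A (Equiv.apply_symm_apply _ _), Equiv.apply_symm_apply]
        omega
    · by_cases hwm : τ w = m'
      · rw [hswap' w hw hwm]
        exact ⟨him, hmk'.le⟩
      · rw [hswap w hw hwm]
        exact hA w hw
    · rw [edgeDir_swap udir τ Q hmm' him.ne, hsum]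
  obtain ⟨R, hR, hR3, l₁, hl₁, hsupp₁⟩ := hl.exists_card_le_three (Finset.Icc i k)
    fun j hj => Finset.mem_Icc.mpr (hsupp j hj)
  have hIcc : ∀ j ∈ R, i ≤ j ∧ j ≤ k := fun j hj => Finset.mem_Icc.mp (hR hj)
  have hz : ∀ j, j ∉ R → l₁ j = 0 := fun j hj => not_not.mp fun h => hj (hsupp₁ j h)
  by_cases hiR : i ∈ R
  swap
  · exact hleft l₁ hl₁ (fun j hj => hIcc j (hsupp₁ j hj)) (hz i hiR)
  by_cases hkR : k ∈ R
  swap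
  · exact hright l₁ hl₁ (fun j hj => hIcc j (hsupp₁ j hj)) (hz k hkR)
  by_cases hmR : m ∈ R
  swap
  · exact hmid l₁ hl₁ (fun j hj => hIcc j (hsupp₁ j hj)) (hz m hmR)
  have hReq : R = {i, m, k} := by
    symm
    refine Finset.eq_of_subset_of_card_le ?_ ?_
    · intro j hj
      simp only [Finset.mem_insert, Finset.mem_singleton] at hj
      rcases hj with rfl | rfl | rfl <;> assumption
    · rw [Finset.card_eq_three.mpr ⟨i, m, k, him.ne, (him.trans hmk').ne, hmk'.ne, rfl⟩]
      exact hR3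
  rcases eq_or_lt_of_le hs with rfl | hs3
  · -- Only two unbounded edges lie in between, and `A` consists of the second one.
    have hm'k : m' = k := by
      refine Fin.ext ?_
      rw [Fin.lt_def] at *
      omega
    have hAeq : A = {τ.symm k} := by
      ext w
      rw [Finset.mem_singleton]
      refine ⟨fun hw => ?_, fun hw => by rw [hw, ← hm'k]; exact hm'A⟩
      obtain ⟨h₁, h₂⟩ := hA w hw
      have h₃ : τ w ≠ m := fun h => hmA (by rwa [← h, Equiv.symm_apply_apply])
      rw [Equiv.eq_symm_apply]
      rw [Ne, Fin.ext_iff] at h₃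
      refine Fin.ext ?_
      simp only [Fin.lt_def, Fin.le_def] at *
      omega
    have hi1 : i + 1 = m := by
      refine Fin.ext ?_
      rw [Fin.val_add_one_of_lt (lt_of_lt_of_le him (Fin.le_last _))]
      simp only [Fin.lt_def] at *
      omega
    have hm1 : m + 1 = k := by
      refine Fin.ext ?_
      rw [Fin.val_add_one_of_lt (lt_of_lt_of_le hmk' (Fin.le_last _))]
      simp only [Fin.lt_def] at *
      omega
    rw [hAeq, Finset.sum_singleton] at hsum
    have hdm := edgeDir_add_one h τ Q i
    rw [hi1, hsum] at hdm
    have hdk := edgeDir_add_one h τ Q m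
    rw [hm1, hdm, sub_right_comm, sub_self, zero_sub] at hdk
    have hall : ∀ {N : Type} [AddCommMonoid N] (F : Fin (M + 1) → N), (∀ j, l₁ j = 0 → F j = 0) →
        ∑ j, F j = F i + F m + F k := by
      intro N _ F hF
      rw [← Finset.sum_subset (Finset.subset_univ R) fun j _ hj => hF j (hz j hj), hReq,
        Finset.sum_insert, Finset.sum_pair hmk'.ne, add_assoc]
      simp only [Finset.mem_insert, Finset.mem_singleton, not_or]
      exact ⟨him.ne, (him.trans hmk').ne⟩
    have hrel := hl₁.sum_eq_zero
    rw [hall _ fun j hj => by rw [hj, zero_smul], hsum, hdm, hdk] at hrel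
    have hpos : l₁ i + l₁ m + l₁ k ≠ 0 := by
      rw [← hall l₁ fun j hj => hj]
      intro h0
      obtain ⟨j, hj⟩ := hl₁.exists_ne_zero
      exact hj ((Finset.sum_eq_zero_iff_of_nonneg fun j _ => hl₁.nonneg j).mp h0 j
        (Finset.mem_univ j))
    rcases exists_eq_zero_of_unimodular (hl₁.nonneg i) (hl₁.nonneg m) (hl₁.nonneg k) hpos
      (h.endDir_mem _) (h.endDir_mem _) hrel with h0 | h0 | h0
    · exact reachesLoop_of_edgeDir_eq_zero h hd (hsum.trans h0)
    · exact reachesLoop_of_edgeDir_eq_zero h hd (hdm.trans h0)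
    · exact reachesLoop_of_edgeDir_eq_zero h hd (hdk.trans h0)
  · -- Another edge inside the interval takes over the role of the `m`-th one.
    obtain ⟨j, hij, hjk, hjm⟩ : ∃ j : Fin (M + 1), i < j ∧ j < k ∧ j ≠ m := by
      by_cases h1 : (m : ℕ) = i + 1
      · refine ⟨⟨i + 2, by have := k.2; omega⟩, ?_, ?_, fun h => ?_⟩
        · simp only [Fin.lt_def]
          omega
        · simp only [Fin.lt_def]
          omega
        · rw [← h] at h1
          simp at h1
      · refine ⟨⟨i + 1, by have := k.2; omega⟩, ?_, ?_, fun h => ?_⟩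
        · simp only [Fin.lt_def]
          omega
        · simp only [Fin.lt_def]
          omega
        · exact h1 (by rw [← h])
    have hjR : j ∉ R := by
      rw [hReq]
      simp only [Finset.mem_insert, Finset.mem_singleton, not_or]
      exact ⟨hij.ne', hjm, hjk.ne⟩
    have hR3' : R.card = 3 := by
      rw [hReq]
      exact Finset.card_eq_three.mpr ⟨i, m, k, him.ne, (him.trans hmk').ne, hmk'.ne, rfl⟩
    obtain ⟨r, hr, hrj, l₂, h₁, h₂, h₃, h₄⟩ := exists_nonneg_relation_erase
      (fun m => toPlane (edgeDir udir τ Q m)) hl₁.nonneg hl₁.exists_ne_zero hl₁.sum_eq_zero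
      (R := insert j R) (fun m hm => Finset.mem_insert_of_mem (hsupp₁ m hm))
      (by rw [Finset.card_insert_of_notMem hjR, hR3']) j
    have hl₂ : IsRelation udir τ Q l₂ := ⟨h₁, h₂, h₃⟩
    have hr0 : l₂ r = 0 := not_not.mp fun h => Finset.notMem_erase r _ (h₄ r h)
    have hsupp₂ : ∀ a, l₂ a ≠ 0 → i ≤ a ∧ a ≤ k := by
      intro a ha
      rcases Finset.mem_insert.mp (Finset.mem_of_mem_erase (h₄ a ha)) with rfl | haR
      · exact ⟨hij.le, hjk.le⟩
      · exact hIcc a haR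
    have hrR := (Finset.mem_insert.mp hr).resolve_left hrj
    rw [hReq] at hrR
    simp only [Finset.mem_insert, Finset.mem_singleton] at hrR
    rcases hrR with rfl | rfl | rfl
    · exact hleft l₂ hl₂ hsupp₂ hr0
    · exact hmid l₂ hl₂ hsupp₂ hr0
    · exact hright l₂ hl₂ hsupp₂ hr0

theorem reachesLoop (h : HasDegree udir d) (hd : 1 ≤ d) (τ : U ⊕ Fin n ≃ Fin (M + 1)) :
    ReachesLoop h hd τ Q := fun x =>
  reachesLoop_of_support h hd M τ 0 (Fin.last M) (by simp) x.1.1 x.isRelation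
    (fun m _ => ⟨Fin.zero_le m, Fin.le_last m⟩) x

end PlanarType

namespace PlanarModuli

open PlanarType

theorem hasDegree_standard (d : ℕ) : HasDegree
    (Sum.elim (fun _ => (1, 1)) (Sum.elim (fun _ => (-1, 0)) fun _ => (0, -1)) :
      Fin d ⊕ Fin d ⊕ Fin d → ℤ × ℤ) d := by
  rw [HasDegree, ← Finset.univ_disjSum_univ, Finset.val_disjSum, ← Finset.univ_disjSum_univ,
    Finset.val_disjSum]
  simp [Multiset.disjSum, Function.comp_def, add_assoc]
  simp only [← Multiset.coe_replicate, Multiset.coe_add]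

theorem joined_loopCurve {d n : ℕ} (hd : 1 ≤ d) (C : PlanarModuli d n) :
    Joined C (mk (loopCurve n (hasDegree_standard d) hd)) := by
  induction C using Quotient.inductionOn with | _ C => ?_
  obtain ⟨D, hD, hCD⟩ := exists_joined_isCycle C
  obtain ⟨M, τ, Q, x, hx⟩ := exists_cyclicType D hD
  have hdeg : HasDegree D.type.udir d := D.isTropical.degree_eq
  have := reachesLoop hdeg hd τ x
  rw [hx, mk_loopCurve_eq hdeg (hasDegree_standard d) hd] at this
  exact hCD.trans this

end PlanarModuli

theorem theorem5p3 (d n : ℕ) (hd : 1 ≤ d) :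
    ConnectedSpace (PlanarModuli d n) ∧
      ∀ C D : PlanarModuli d n, Joined C D := by
  have hJ : ∀ C D : PlanarModuli d n, Joined C D := fun C D =>
    (PlanarModuli.joined_loopCurve hd C).trans (PlanarModuli.joined_loopCurve hd D).symm
  have : PathConnectedSpace (PlanarModuli d n) :=
    ⟨⟨PlanarModuli.mk (PlanarType.loopCurve n (PlanarModuli.hasDegree_standard d) hd)⟩, hJ⟩
  exact ⟨inferInstance, hJ⟩
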